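/- **Setting.** Let $f:\mathbb R^d\times\mathcal Z\to\mathbb R$, let $\mathcal D$ be a probability distribution on $\mathcal Z$ and $F(x)=\mathbb E_{z\sim\mathcal D}[f(x,z)]$; let $x^\star$ be a minimizer of $F$ on $\mathbb R^d$. Assume that, for every $z$, $f(\cdot,z)$ is differentiable with $L$-Lipschitz gradient, $L>0$, and that, for all $x\in\mathbb R^d$ and $k\in[d]$, $f_k(x,z)=\partial_kf(x,z)-\partial_kF(x)$ is sub-gamma with variance factor $\sigma\ge 0$ and scale parameter $a\ge0$: $\log\mathbb E_{z\sim\mathcal D}[e^{\lambda f_k(x,z)}]\le\frac{\lambda^2\sigma^2}{2(1-a|\lambda|)}$ (finite exponential moment) whenever $a|\lambda|<1$. There are $N\ge1$ agents. Each agent is at each iteration $t\ge1$ either Byzantine or trustworthy, and these states evolve as $N$ independent two-state Markov chains with an arbitrary initial law and transition probabilities $p_b$ (trustworthy to Byzantine) and $p_t$ (Byzantine to trustworthy), $0<p_b<p_t<1$. At iteration $t$ every agent $i$ draws $b\ge1$ fresh independent samples $z_{i,t}^1,\dots,z_{i,t}^b\sim\mathcal D$ (stochastic approximation setting), independent of the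 past and of the current states; a trustworthy agent sends $g_{i,t}=\frac1b\sum_{j=1}^b\nabla f(x_t,z_{i,t}^j)$, a Byzantine agent sends an arbitrary vector $g_{i,t}$, which may depend on everything that has happened up to and including iteration $t$ (and given everything that has happened up to iteration $t$, the next states follow the Markov chains). For $k$ vectors and $\alpha\in[0,\frac12)$ with $\alpha k\in\mathbb N_0$, the robust mean with threshold $\alpha$ is, in each coordinate, the average of the $(1-\alpha)k$ entries nearest to the median of the $k$ entries (ties broken in any way). RANGE, with $x_1\in\mathbb R^d$, step size $\gamma$, window $m\ge1$ and $\alpha_1,\alpha_2<\frac12$ with $\alpha_1m,\alpha_2N\in\mathbb N_0$, computes for $t=1,\dots,T+m-1+m_0$: $\hat g_{i,t}=g_{i,t}$ if $t<m$, and otherwise $\hat g_{i,t}$ is the robust mean with threshold $\alpha_1$ of $g_{i,t},g_{i,t-1},\dots,g_{i,t-m+1}$; then the robust mean $\hat{\hat g}_t$ with threshold $\alpha_2$ of $\hat g_{1,t},\dots,\hat g_{N,t}$; then $x_{t+1}=x_t-\gamma\,\hat{\hat g}_t/\|\hat{\hat g}_t\|$, where $0/\|0\|=0$. For $t\ge m+m_0$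 let $Z_t=1$ if for more than $\alpha_2N$ agents the number of iterations $\tau\in[t-m+1,t]$ at which the agent is Byzantine exceeds $\alpha_1m$, and $Z_t=0$ otherwise. Let $P_Z^m(m_0)$ be the maximum, over all configurations of the $N$ agents' states at iteration $t-m+1-m_0$, of the conditional probability that $Z_t=1$ given that configuration (it does not depend on $t$). For $i=1,2$ put $$C_{\alpha_i}=\frac{2\alpha_i}{1-\alpha_i}\left(1+\sqrt{\frac{(1-\alpha_i)^2}{1-2\alpha_i}}\right)\sqrt d,$$ $$\overline C(m_0)=L\Big(\tfrac12+4(m-1+m_0)P_Z^m(m_0)+2(m-1)\big(1+C_{\alpha_1}+2C_{\alpha_2}(C_{\alpha_1}+1)\big)\Big).$$ **Theorem 4.** Let $\gamma=\gamma_0/\sqrt T$ with $\gamma_0>0$, let $m_0\in\mathbb N_0$, and suppose $P_Z^m(m_0)<\frac12$. Then for every $T\ge1$ the iterates of RANGE in the stochastic approximation setting satisfy, with $\Delta=1-2P_Z^m(m_0)$ and $M(n)=\sigma\sqrt{2\log n}/\sqrt b+a\log n/b$, $$\begin{aligned}\frac1T\sum_{t=m+m_0}^{T+m-1+m_0}\mathbb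 E\|\nabla F(x_t)\|\le{}&\frac{F(x_1)-F(x^\star)}{\sqrt T\gamma_0\Delta}+\frac{\overline C(m_0)\gamma_0}{\sqrt T\Delta}+\frac{\|\nabla F(x_1)\|(m-1+m_0)}{T\Delta}+\frac{L\gamma_0(m-1+m_0)^2}{2T^{3/2}\Delta}\\&+\frac1\Delta\Big(\frac{2\sigma\sqrt d}{\sqrt{(1-\alpha_1)m(1-\alpha_2)Nb}}+4C_{\alpha_2}M\big(2(1-\alpha_2)Nd\big)+4C_{\alpha_1}M\big(4(1-\alpha_1)md\big)\\&\qquad+8C_{\alpha_1}C_{\alpha_2}M\big(4(1-\alpha_2)N(1-\alpha_1)md\big)\Big),\end{aligned}$$ all expectations being finite. When $d\ge1$, the right-hand side is $\frac{F(x_1)-F(x^\star)}{\sqrt T\gamma_0\Delta}+\frac{\overline C(m_0)\gamma_0}{\sqrt T\Delta}+O(\frac1T)+O\Big(\frac1{\sqrt{(1-\alpha_1)mNb}}+\frac{C_{\alpha_2}+C_{\alpha_1}(1+C_{\alpha_2})}{\sqrt b}\Big)$, where $O$ hides constants and logarithmic factors. -/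

import Mathlib

open MeasureTheory ProbabilityTheory

noncomputable section

/-- The parameter space `ℝ^d` with its Euclidean norm. -/
abbrev Vec (d : ℕ) : Type := EuclideanSpace ℝ (Fin d)

/-! ### The median-based mean estimator -/

/-- `c` is a median of `y 0, …, y (k-1)`: at least half of the entries are `≤ c` and at least half
are `≥ c`.  (For even `k` every point between the two middle entries is allowed.) -/
def IsMedian {k : ℕ} (y : Fin k → ℝ) (c : ℝ) : Prop :=
  k ≤ 2 * (Finset.univ.filter fun i => y i ≤ c).card ∧
  k ≤ 2 * (Finset.univ.filter fun i => c ≤ y i).card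

/-- `u` is an output of the median-based mean estimator with threshold `α` on the vectors
`v 0, …, v (k-1)`: in each coordinate it is the mean of `(1-α)k` entries nearest to the median.
(Ties between equally near entries may be broken in any way.) -/
def IsRobustMean {d k : ℕ} (α : ℝ) (v : Fin k → Vec d) (u : Vec d) : Prop :=
  ∀ j : Fin d, ∃ (c : ℝ) (S : Finset (Fin k)),
    IsMedian (fun i => v i j) c ∧
    (S.card : ℝ) = (1 - α) * k ∧
    (∀ i ∈ S, ∀ l ∉ S, |v i j - c| ≤ |v l j - c|) ∧
    u j = 1 / ((1 - α) * k) * ∑ i ∈ S, v i j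

/-! ### The optimization problem -/

/-- `F(x) = 𝔼_{z ∼ D} f(x,z)`. -/
def risk {d : ℕ} {Z : Type*} [MeasurableSpace Z] (D : Measure Z) (f : Vec d → Z → ℝ)
    (x : Vec d) : ℝ :=
  ∫ z, f x z ∂D

/-- The empirical risk `x ↦ (1/b) ∑ⱼ f(x, zⱼ)` of a minibatch. -/
def empiricalRisk {d b : ℕ} {Z : Type*} (f : Vec d → Z → ℝ) (z : Fin b → Z) (x : Vec d) : ℝ :=
  1 / (b : ℝ) * ∑ j, f x (z j)

/-- `φ` is differentiable with `L`-Lipschitz gradient. -/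
def IsSmooth {d : ℕ} (L : ℝ) (φ : Vec d → ℝ) : Prop :=
  Differentiable ℝ φ ∧ ∀ x y, ‖gradient φ x - gradient φ y‖ ≤ L * ‖x - y‖

/-- `X` is sub-gamma with variance factor `σ` (that is, `σ²` in the exponent) and scale parameter
`a`; for `a = 0` the bound is required for every `l`. -/
def IsSubGamma {Z : Type*} [MeasurableSpace Z] (D : Measure Z) (X : Z → ℝ) (σ a : ℝ) : Prop :=
  ∀ l : ℝ, a * |l| < 1 →
    Integrable (fun z => Real.exp (l * X z)) D ∧
    Real.log (∫ z, Real.exp (l * X z) ∂D) ≤ l ^ 2 * σ ^ 2 / (2 * (1 - a * |l|))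

/-! ### Agents' states; `true` is Byzantine and `false` is trustworthy -/

/-- The transition matrix of the two-state Markov chain of one agent. -/
def transProb (pb pt : ℝ) : Bool → Bool → ℝ
  | false, false => 1 - pb
  | false, true => pb
  | true, false => pt
  | true, true => 1 - pt

/-- For states `s 0, …, s n` of the `N` agents at consecutive times: more than `α₂ N` of
the agents are Byzantine at more than `α₁ m` of the times `r` with `m₀ ≤ r ≤ n`. -/
def AggregationFails {N n : ℕ} (m m₀ : ℕ) (α₁ α₂ : ℝ) (s : Fin (n + 1) → Fin N → Bool) : Prop :=
  α₂ * N < ((Finset.univ.filter fun i : Fin N =>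
    α₁ * m < ((Finset.univ.filter fun r : Fin (n + 1) =>
      m₀ ≤ (r : ℕ) ∧ s r i = true).card : ℝ)).card : ℝ)

open Classical in
/-- For `N` independent chains in the states `w` at a time `s`, the probability that robust
aggregation fails at time `s + m₀ + m - 1`, where the window consists of the `m` times
`s + m₀, …, s + m₀ + m - 1`. -/
def failProb (m m₀ N : ℕ) (α₁ α₂ pb pt : ℝ) (w : Fin N → Bool) : ℝ :=
  ∑ q : Fin (m₀ + m - 1) → Fin N → Bool,
    if AggregationFails m m₀ α₁ α₂ (Fin.cons w q : Fin (m₀ + m - 1 + 1) → Fin N → Bool) then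
      ∏ r : Fin (m₀ + m - 1), ∏ i : Fin N,
        transProb pb pt ((Fin.cons w q : Fin (m₀ + m - 1 + 1) → Fin N → Bool) r.castSucc i)
          ((Fin.cons w q : Fin (m₀ + m - 1 + 1) → Fin N → Bool) r.succ i)
    else 0

/-- `P_Z^m(m₀)`: the uniform bound on the conditional probability of failure given the states
`m₀ + m - 1` steps earlier, that is, the failure probability from the worst states. -/
def PZ (m m₀ N : ℕ) (α₁ α₂ pb pt : ℝ) : ℝ :=
  ⨆ w : Fin N → Bool, failProb m m₀ N α₁ α₂ pb pt w

/-! ### The random environment and the algorithm -/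

/-- The stochastic approximation setting with Markovian corruption. `ℱ t` is the information
available up to and including iteration `t` (states, samples, and whatever else the adversary uses).
The states of the agents are `N` independent two-state Markov chains with arbitrary initial law,
and in each iteration every agent draws `b` fresh independent samples from `D`. -/
structure IsSASetting {Ω Z : Type*} [mΩ : MeasurableSpace Ω] [MeasurableSpace Z] {N b : ℕ}
    (μ : Measure Ω) (ℱ : Filtration ℕ mΩ) (D : Measure Z) (pb pt : ℝ)
    (W : ℕ → Ω → Fin N → Bool) (ζ : ℕ → Ω → Fin N → Fin b → Z) : Prop where
  measurable_state : ∀ t, 1 ≤ t → Measurable[ℱ t] (W t)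
  measurable_sample : ∀ t, 1 ≤ t → Measurable[ℱ t] (ζ t)
  markov : ∀ t, 1 ≤ t → ∀ w : Fin N → Bool,
    μ[Set.indicator {ω | W (t + 1) ω = w} (fun _ => (1 : ℝ)) | ℱ t]
      =ᵐ[μ] fun ω => ∏ i, transProb pb pt (W t ω i) (w i)
  sample_law : ∀ t, 1 ≤ t →
    μ.map (ζ t) = Measure.pi fun _ : Fin N => Measure.pi fun _ : Fin b => D
  sample_indep : ∀ t, 1 ≤ t →
    Indep (MeasurableSpace.comap (ζ t) inferInstance)
      (ℱ (t - 1) ⊔ MeasurableSpace.comap (W t) inferInstance) μ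

/-- `x`, `g`, `g'`, `g''` (iterates, received feedback, temporally averaged feedback, aggregate)
form a run of RANGE over the iterations `t = 1, …, n`, unconstrained, with step size `γ`, window `m`
and thresholds `α₁`, `α₂`. The feedback of a Byzantine agent at time `t` is an arbitrary function
of the information `ℱ t`. In the update, `g'' / ‖g''‖` is `0` if `g'' = 0`. -/
structure IsRangeRun {Ω Z : Type*} [mΩ : MeasurableSpace Ω] {d N b : ℕ}
    (ℱ : Filtration ℕ mΩ) (f : Vec d → Z → ℝ)
    (W : ℕ → Ω → Fin N → Bool) (ζ : ℕ → Ω → Fin N → Fin b → Z)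
    (m : ℕ) (α₁ α₂ γ : ℝ) (x₁ : Vec d) (n : ℕ)
    (x : ℕ → Ω → Vec d) (g g' : ℕ → Fin N → Ω → Vec d) (g'' : ℕ → Ω → Vec d) : Prop where
  measurable_feedback : ∀ t, 1 ≤ t → t ≤ n → ∀ i, Measurable[ℱ t] (g t i)
  measurable_averaged : ∀ t, 1 ≤ t → t ≤ n → ∀ i, Measurable[ℱ t] (g' t i)
  measurable_aggregate : ∀ t, 1 ≤ t → t ≤ n → Measurable[ℱ t] (g'' t)
  init : ∀ ω, x 1 ω = x₁
  trustworthy : ∀ t, 1 ≤ t → t ≤ n → ∀ i ω, W t ω i = false →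
    g t i ω = gradient (empiricalRisk f (ζ t ω i)) (x t ω)
  warmup : ∀ t, 1 ≤ t → t ≤ n → t < m → ∀ i ω, g' t i ω = g t i ω
  temporal : ∀ t, 1 ≤ t → t ≤ n → m ≤ t → ∀ i ω,
    IsRobustMean α₁ (fun τ : Fin m => g (t - (τ : ℕ)) i ω) (g' t i ω)
  aggregate : ∀ t, 1 ≤ t → t ≤ n → ∀ ω,
    IsRobustMean α₂ (fun i : Fin N => g' t i ω) (g'' t ω)
  update : ∀ t, 1 ≤ t → t ≤ n → ∀ ω,
    x (t + 1) ω = x t ω - γ • (‖g'' t ω‖⁻¹ • g'' t ω)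

/-! ### Constants -/

/-- `C_α = (2α/(1-α)) (1 + √((1-α)²/(1-2α))) √d`. -/
def constC (d : ℕ) (α : ℝ) : ℝ :=
  2 * α / (1 - α) * (1 + Real.sqrt ((1 - α) ^ 2 / (1 - 2 * α))) * Real.sqrt d

/-- `C̄(m₀)`, with `C₁ = C_{α₁}`, `C₂ = C_{α₂}`, `P = P_Z^m(m₀)`. -/
def constCbar (L : ℝ) (m m₀ : ℕ) (P C₁ C₂ : ℝ) : ℝ :=
  L * (1 / 2 + 4 * ((m : ℝ) - 1 + m₀) * P
    + 2 * ((m : ℝ) - 1) * (1 + C₁ + 2 * C₂ * (C₁ + 1)))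

/-- The size `σ √(2 log n) / √b + a log n / b` of the maximum of `n` centred sub-gamma minibatch
averages. -/
def maxDev (σ a : ℝ) (b : ℕ) (n : ℝ) : ℝ :=
  σ * Real.sqrt (2 * Real.log n) / Real.sqrt b + a * Real.log n / b

end

/-! The argument is a descent argument for normalized steps with an inexact direction. A step along
`v / ‖v‖` decreases `F` by `γ ‖∇F‖`, up to `2γ ‖v - ∇F‖` and a quadratic term, and whatever `v` is,
`F` increases by at most `γ ‖∇F‖` plus that quadratic term (`IsSmooth.normalized_step`). A failed
aggregation thus costs at most `2γ ‖∇F‖` more than an exact one. If failure has conditional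
probability at most `P < 1/2`, a positive fraction `1 - 2P` of the descent survives;
`sum_integral_le_of_descent` telescopes it.

Failure at time `t` may be correlated with `x t`, whereas `P` is a bound given the states `m₀ + m -
1` steps earlier. All steps have length at most `γ`, so `‖∇F(x t)‖` can be exchanged for the
gradient norm at that earlier time at a cost linear in `γ`, and then `setIntegral_failEvent_le`
applies.

Without failure, there are `(1-α₂)N` agents that are trustworthy at `(1-α₁)m` times of the window
each. A robust mean is close to the plain mean over any set of the same size whose entries are
concentrated (`IsRobustMean.abs_sub_mean_le`). Applied in time and then across agents, this bounds
the error by the drift of the gradient over the window, the norm of the average noise over the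
trustworthy entries, and maxima of noises weighted by `C_α` (`norm_aggregate_sub_le`).

The selected entries depend on the states of the whole window, including states later than a given
sample. This does not bias the noise: given the information at time `u`, later states depend only on
the states at time `u`, which are independent of the samples of that time
(`setIntegral_statePath_nonpos`). The noises therefore stay centred and uncorrelated given the path,
so their average has order `1/√Q` for `Q` selected entries, while a sub-gamma maximal inequality
(`integral_pi_norm_le`) controls the maxima. -/

/-! ### The median-based mean estimator -/

/-- A median of `k` numbers lies between any two bounds valid for more than half of them. -/
lemma IsMedian.abs_sub_le {k : ℕ} {y : Fin k → ℝ} {c w B : ℝ} (hc : IsMedian y c)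
    {G : Finset (Fin k)} (hG : k < 2 * G.card) (hB : ∀ i ∈ G, |y i - w| ≤ B) : |c - w| ≤ B := by
  have meets (p : Fin k → Prop) [DecidablePred p] (hp : k ≤ 2 * (Finset.univ.filter p).card) :
      ∃ i ∈ G, p i := by
    by_contra! h
    have hd : Disjoint G (Finset.univ.filter p) := by
      rw [Finset.disjoint_left]
      intro i hi hi'
      exact h i hi (Finset.mem_filter.mp hi').2
    have := Finset.card_le_univ (G ∪ Finset.univ.filter p)
    rw [Finset.card_union_of_disjoint hd, Fintype.card_fin] at this
    omega
  obtain ⟨i, hi, hic⟩ := meets _ hc.1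
  obtain ⟨l, hl, hlc⟩ := meets _ hc.2
  have h1 := abs_le.mp (hB i hi)
  have h2 := abs_le.mp (hB l hl)
  rw [abs_le]
  constructor <;> linarith

/-- The average of the entries nearest to the median differs from the average of a set of entries
of the same size by at most `4α/(1-α)` times the deviation of the latter from any point. -/
lemma IsRobustMean.abs_sub_mean_le {d k : ℕ} {α : ℝ} {v : Fin k → Vec d} {u : Vec d}
    (hu : IsRobustMean α v u) (hα : α < 1 / 2) (hk : 1 ≤ k)
    {G : Finset (Fin k)} (hG : (G.card : ℝ) = (1 - α) * k) (j : Fin d) {w B : ℝ}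
    (hB : ∀ i ∈ G, |v i j - w| ≤ B) :
    |u j - 1 / ((1 - α) * k) * ∑ i ∈ G, v i j| ≤ 4 * α / (1 - α) * B := by
  obtain ⟨c, S, hc, hS, hnear, huj⟩ := hu j
  have hk' : (1 : ℝ) ≤ k := by exact_mod_cast hk
  have hq : 0 < (1 - α) * k := by apply mul_pos <;> linarith
  have hGk : k < 2 * G.card := by
    have : (k : ℝ) < 2 * G.card := by rw [hG]; nlinarith
    exact_mod_cast this
  have hcw := hc.abs_sub_le hGk hB
  have hcard : S.card = G.card := by exact_mod_cast hS.trans hG.symm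
  -- Equal cardinality of the two differences makes the reference point `c` cancel in `hdiff`, so
  -- only deviations from the median enter.
  have hsd : (S \ G).card = (G \ S).card := by
    have h1 := Finset.card_sdiff_add_card_inter S G
    have h2 := Finset.card_sdiff_add_card_inter G S
    rw [Finset.inter_comm] at h2
    omega
  have hr : ((G \ S).card : ℝ) ≤ α * k := by
    have h1 := Finset.card_le_univ (G \ S ∪ S)
    rw [Finset.card_union_of_disjoint Finset.sdiff_disjoint, Fintype.card_fin] at h1
    have : ((G \ S).card : ℝ) + S.card ≤ k := by exact_mod_cast h1
    rw [hS] at this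
    linarith
  have hGB : ∀ l ∈ G, |v l j - c| ≤ 2 * B := by
    intro l hl
    calc |v l j - c| = |(v l j - w) - (c - w)| := by ring_nf
      _ ≤ |v l j - w| + |c - w| := abs_sub _ _
      _ ≤ 2 * B := by linarith [hB l hl]
  -- A foreign entry was chosen in place of some entry of `G`, hence it lies at least as near to the
  -- median. This is what tames Byzantine entries.
  have hSB : ∀ i ∈ S \ G, |v i j - c| ≤ 2 * B := by
    intro i hi
    have : (G \ S).Nonempty := by
      rw [← Finset.card_pos, ← hsd, Finset.card_pos]
      exact ⟨i, hi⟩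
    obtain ⟨l, hl⟩ := this
    rw [Finset.mem_sdiff] at hi hl
    exact (hnear i hi.1 l hl.2).trans (hGB l hl.1)
  have hdiff : ∑ i ∈ S, v i j - ∑ i ∈ G, v i j
      = ∑ i ∈ S \ G, (v i j - c) - ∑ i ∈ G \ S, (v i j - c) := by
    rw [Finset.sum_sub_distrib, Finset.sum_sub_distrib, Finset.sum_const, Finset.sum_const, hsd]
    have := Finset.sum_sdiff_sub_sum_sdiff (s₁ := S) (s₂ := G) (f := fun i => v i j)
    linarith
  have hB0 : 0 ≤ B := (abs_nonneg _).trans hcw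
  have hsum : |∑ i ∈ S, v i j - ∑ i ∈ G, v i j| ≤ 4 * (α * k) * B := by
    rw [hdiff]
    have h1 : |∑ i ∈ S \ G, (v i j - c)| ≤ (S \ G).card * (2 * B) :=
      (Finset.abs_sum_le_sum_abs _ _).trans
        ((Finset.sum_le_card_nsmul _ _ _ hSB).trans_eq (nsmul_eq_mul _ _))
    have h2 : |∑ i ∈ G \ S, (v i j - c)| ≤ (G \ S).card * (2 * B) :=
      (Finset.abs_sum_le_sum_abs _ _).trans
        ((Finset.sum_le_card_nsmul _ _ _ fun l hl => hGB l (Finset.mem_sdiff.mp hl).1).trans_eq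
          (nsmul_eq_mul _ _))
    rw [hsd] at h1
    refine (abs_sub _ _).trans ?_
    nlinarith [mul_le_mul_of_nonneg_right hr hB0]
  rw [huj, ← mul_sub, abs_mul, abs_of_pos (by positivity)]
  calc 1 / ((1 - α) * k) * |∑ i ∈ S, v i j - ∑ i ∈ G, v i j|
      ≤ 1 / ((1 - α) * k) * (4 * (α * k) * B) := by gcongr
    _ = 4 * α / (1 - α) * B := by
        have : 1 - α ≠ 0 := by linarith
        field_simp

/-- `4α/(1-α) √d ≤ C_α`. -/
lemma mul_sqrt_le_constC (d : ℕ) {α : ℝ} (hα₀ : 0 ≤ α) (hα : α < 1 / 2) :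
    4 * α / (1 - α) * Real.sqrt d ≤ constC d α := by
  have h1 : 1 ≤ Real.sqrt ((1 - α) ^ 2 / (1 - 2 * α)) := by
    rw [Real.one_le_sqrt, one_le_div (by linarith)]
    nlinarith
  have h2 : 0 ≤ 2 * α / (1 - α) := div_nonneg (by linarith) (by linarith)
  unfold constC
  refine mul_le_mul_of_nonneg_right ?_ (Real.sqrt_nonneg _)
  calc 4 * α / (1 - α) = 2 * α / (1 - α) * 2 := by ring
    _ ≤ _ := by gcongr; linarith

lemma constC_nonneg (d : ℕ) {α : ℝ} (hα₀ : 0 ≤ α) (hα : α < 1 / 2) : 0 ≤ constC d α :=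
  le_trans (mul_nonneg (div_nonneg (by linarith) (by linarith)) (Real.sqrt_nonneg _))
    (mul_sqrt_le_constC d hα₀ hα)

/-! ### Smooth functions and normalized steps -/

lemma IsSmooth.hasGradientAt {d : ℕ} {L : ℝ} {φ : Vec d → ℝ} (h : IsSmooth L φ) (x : Vec d) :
    HasGradientAt φ (gradient φ x) x :=
  (h.1 x).hasGradientAt

lemma IsSmooth.abs_sub_linear_le {d : ℕ} {L : ℝ} {φ : Vec d → ℝ} (h : IsSmooth L φ)
    (x y : Vec d) :
    |φ y - φ x - inner ℝ (gradient φ x) (y - x)| ≤ L / 2 * ‖y - x‖ ^ 2 := by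
  set v := y - x with hv
  have hd : ∀ t : ℝ, HasDerivAt
      (fun t : ℝ => φ (x + t • v) - φ x - t * inner ℝ (gradient φ x) v)
      (inner ℝ (gradient φ (x + t • v)) v - inner ℝ (gradient φ x) v) t := by
    intro t
    have h1 : HasDerivAt (fun t : ℝ => x + t • v) v t := by
      simpa using ((hasDerivAt_id t).smul_const v).const_add x
    have h2 := (h.hasGradientAt (x + t • v)).hasFDerivAt.comp_hasDerivAt t h1
    have h3 := (hasDerivAt_id t).mul_const (inner ℝ (gradient φ x) v)
    refine ((h2.sub_const (φ x)).sub h3).congr_deriv ?_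
    simp
  have hB : ∀ t : ℝ, HasDerivAt (fun t : ℝ => L / 2 * ‖v‖ ^ 2 * t ^ 2) (L * ‖v‖ ^ 2 * t) t := by
    intro t
    have := (hasDerivAt_pow 2 t).const_mul (L / 2 * ‖v‖ ^ 2)
    exact this.congr_deriv (by push_cast; ring)
  -- The remainder along the segment vanishes at `0` and has derivative at most `L ‖v‖² t`;
  -- comparison with the primitive of this bound gives the factor `1/2`.
  have key := image_norm_le_of_norm_deriv_right_le_deriv_boundary (a := 0) (b := 1)
    (fun t _ => (hd t).continuousAt.continuousWithinAt)
    (fun t _ => (hd t).hasDerivWithinAt)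
    (B := fun t : ℝ => L / 2 * ‖v‖ ^ 2 * t ^ 2) (by simp) hB
    (fun t ht => by
      rw [← inner_sub_left]
      refine (norm_inner_le_norm _ _).trans ?_
      have := h.2 (x + t • v) x
      rw [add_sub_cancel_left, norm_smul, Real.norm_of_nonneg ht.1] at this
      calc _ ≤ L * (t * ‖v‖) * ‖v‖ := by gcongr
        _ = _ := by ring)
    (Set.right_mem_Icc.mpr zero_le_one)
  simpa [hv] using key

lemma IsSmooth.continuous_gradient {d : ℕ} {L : ℝ} {φ : Vec d → ℝ} (h : IsSmooth L φ) :
    Continuous (gradient φ) := by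
  have : LipschitzWith L.toNNReal (gradient φ) := LipschitzWith.of_dist_le_mul fun x y => by
    rw [dist_eq_norm, dist_eq_norm]
    exact (h.2 x y).trans (by gcongr; exact Real.le_coe_toNNReal L)
  exact this.continuous

/-- Replacing `u` by `v` in the inner product costs `‖v - u‖`, and so does replacing `‖v‖` by `‖u‖`;
this is the factor `2`. For `v = 0` the normalized vector is `0` and `‖v - u‖ = ‖u‖`. -/
lemma neg_inner_normalized_le {E : Type*} [NormedAddCommGroup E] [InnerProductSpace ℝ E]
    (u v : E) : -inner ℝ u (‖v‖⁻¹ • v) ≤ -‖u‖ + 2 * ‖v - u‖ := by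
  have h1 : ‖u‖ ≤ ‖v‖ + ‖v - u‖ := by
    have := norm_sub_le v (v - u)
    rwa [sub_sub_cancel] at this
  rcases eq_or_ne v 0 with rfl | hv
  · simp at h1 ⊢
    linarith [norm_nonneg u]
  have hv' : 0 < ‖v‖ := norm_pos_iff.mpr hv
  have hn : ‖‖v‖⁻¹ • v‖ = 1 := by
    rw [norm_smul, norm_inv, norm_norm, inv_mul_cancel₀ hv'.ne']
  have h2 : inner ℝ v (‖v‖⁻¹ • v) = ‖v‖ := by
    rw [inner_smul_right, real_inner_self_eq_norm_sq]
    field_simp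
  have h3 : inner ℝ (v - u) (‖v‖⁻¹ • v) ≤ ‖v - u‖ := by
    simpa [hn] using real_inner_le_norm (v - u) (‖v‖⁻¹ • v)
  rw [inner_sub_left, h2] at h3
  linarith

lemma norm_normalized_le_one {E : Type*} [NormedAddCommGroup E] [NormedSpace ℝ E]
    (v : E) : ‖‖v‖⁻¹ • v‖ ≤ 1 := by
  rw [norm_smul, norm_inv, norm_norm]
  exact inv_mul_le_one

/-- Decrease of a smooth function along a normalized step. -/
lemma IsSmooth.normalized_step {d : ℕ} {L γ : ℝ} {φ : Vec d → ℝ} (h : IsSmooth L φ)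
    (hL : 0 ≤ L) (hγ : 0 ≤ γ) (x v : Vec d) :
    φ (x - γ • (‖v‖⁻¹ • v)) ≤ φ x + γ * ‖gradient φ x‖ + L / 2 * γ ^ 2 ∧
    φ (x - γ • (‖v‖⁻¹ • v))
      ≤ φ x - γ * ‖gradient φ x‖ + 2 * γ * ‖v - gradient φ x‖ + L / 2 * γ ^ 2 := by
  set e := ‖v‖⁻¹ • v with he
  have he1 : ‖e‖ ≤ 1 := norm_normalized_le_one v
  have h1 := (abs_le.mp (h.abs_sub_linear_le x (x - γ • e))).2
  have h2 : x - γ • e - x = -(γ • e) := by abel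
  rw [h2, norm_neg, norm_smul, inner_neg_right, inner_smul_right, Real.norm_of_nonneg hγ] at h1
  have h3 : L / 2 * (γ * ‖e‖) ^ 2 ≤ L / 2 * γ ^ 2 := by
    have : γ * ‖e‖ ≤ γ := mul_le_of_le_one_right hγ he1
    gcongr
  have h4 : -inner ℝ (gradient φ x) e ≤ ‖gradient φ x‖ := by
    have := neg_le_of_abs_le (abs_real_inner_le_norm (gradient φ x) e)
    nlinarith [norm_nonneg (gradient φ x)]
  have h5 := neg_inner_normalized_le (gradient φ x) v
  constructor
  · nlinarith [mul_le_mul_of_nonneg_left h4 hγ]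
  · nlinarith [mul_le_mul_of_nonneg_left h5 hγ]

/-! ### Sub-gamma random variables -/

/-- The right-hand side is `(2 sinh (y/2))²`. It turns exponential moments into second moments
without differentiating under the integral. -/
lemma sq_le_exp_add_exp_neg_sub_two (y : ℝ) : y ^ 2 ≤ Real.exp y + Real.exp (-y) - 2 := by
  have h1 : Real.exp y + Real.exp (-y) - 2 = (2 * Real.sinh (y / 2)) ^ 2 := by
    have e1 : Real.exp y = Real.exp (y / 2) ^ 2 := by rw [← Real.exp_nat_mul]; push_cast; ring_nf
    have e2 : Real.exp (-y) = Real.exp (-(y / 2)) ^ 2 := by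
      rw [← Real.exp_nat_mul]; push_cast; ring_nf
    have e3 : Real.exp (y / 2) * Real.exp (-(y / 2)) = 1 := by rw [← Real.exp_add]; simp
    rw [Real.sinh_eq, e1, e2]
    linear_combination 2 * e3
  rw [h1]
  have h2 : |y / 2| ≤ |Real.sinh (y / 2)| := by
    rcases le_total 0 (y / 2) with h | h
    · rw [abs_of_nonneg h, abs_of_nonneg (Real.sinh_nonneg_iff.mpr h)]
      exact Real.self_le_sinh_iff.mpr h
    · rw [abs_of_nonpos h, abs_of_nonpos (Real.sinh_nonpos_iff.mpr h)]
      exact neg_le_neg (Real.sinh_le_self_iff.mpr h)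
  rw [sq_le_sq, abs_mul]
  rw [abs_div] at h2
  simp at h2 ⊢
  linarith

lemma exp_sub_one_le_mul_exp (y : ℝ) : Real.exp y - 1 ≤ y * Real.exp y := by
  have h := Real.add_one_le_exp (-y)
  have h2 : Real.exp (-y) * Real.exp y = 1 := by rw [← Real.exp_add]; simp
  nlinarith [Real.exp_pos y]

namespace IsSubGamma

variable {Z : Type*} [MeasurableSpace Z] {D : Measure Z} {X : Z → ℝ} {σ a : ℝ}

lemma integrable_exp (h : IsSubGamma D X σ a) {l : ℝ} (hl : a * |l| < 1) :
    Integrable (fun z => Real.exp (l * X z)) D := (h l hl).1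

lemma integral_exp_le (h : IsSubGamma D X σ a) {l : ℝ} (hl : a * |l| < 1) :
    ∫ z, Real.exp (l * X z) ∂D ≤ Real.exp (l ^ 2 * σ ^ 2 / (2 * (1 - a * |l|))) := by
  have h0 : 0 ≤ ∫ z, Real.exp (l * X z) ∂D := integral_nonneg fun z => (Real.exp_pos _).le
  -- Inverting the logarithm needs a positive integral; a vanishing one satisfies the bound
  -- trivially.
  rcases h0.eq_or_lt with h1 | h1
  · rw [← h1]; exact (Real.exp_pos _).le
  · exact (Real.log_le_iff_le_exp h1).mp (h l hl).2

lemma neg (h : IsSubGamma D X σ a) : IsSubGamma D (fun z => -X z) σ a := by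
  intro l hl
  have := h (-l) (by simpa using hl)
  simpa using this

lemma eventually_mul_lt_one (a : ℝ) : ∀ᶠ l : ℝ in nhdsWithin 0 (Set.Ioi 0), a * |l| < 1 ∧ 0 < l := by
  have h1 : Filter.Tendsto (fun l : ℝ => a * |l|) (nhdsWithin 0 (Set.Ioi 0)) (nhds 0) := by
    have : Continuous fun l : ℝ => a * |l| := by fun_prop
    simpa using (this.tendsto 0).mono_left nhdsWithin_le_nhds
  exact (h1.eventually_lt_const one_pos).and self_mem_nhdsWithin

lemma integrable_sq (h : IsSubGamma D X σ a) (hX : AEStronglyMeasurable X D) :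
    Integrable (fun z => X z ^ 2) D := by
  obtain ⟨l, hl, hl0⟩ := (eventually_mul_lt_one a).exists
  have h1 := h.integrable_exp hl
  have h2 := h.integrable_exp (l := -l) (by simpa using hl)
  refine ((h1.add h2).const_mul (l ^ 2)⁻¹).mono' (hX.pow 2) (ae_of_all _ fun z => ?_)
  have := sq_le_exp_add_exp_neg_sub_two (l * X z)
  rw [Real.norm_of_nonneg (sq_nonneg _), inv_mul_eq_div, le_div_iff₀ (by positivity)]
  simp only [Pi.add_apply, neg_mul]
  nlinarith

lemma memLp_two (h : IsSubGamma D X σ a) (hX : AEStronglyMeasurable X D) : MemLp X 2 D :=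
  (memLp_two_iff_integrable_sq hX).mpr (h.integrable_sq hX)

lemma integrable [IsFiniteMeasure D] (h : IsSubGamma D X σ a) (hX : AEStronglyMeasurable X D) :
    Integrable X D := (h.memLp_two hX).integrable one_le_two

/-- With `ψ` the exponent, `l 𝔼X ≤ 𝔼 exp(lX) - 1 ≤ exp ψ - 1 ≤ ψ exp ψ`. Since `ψ` is quadratic in
`l` to leading order, dividing by `l` and letting `l` decrease to `0` leaves nothing. -/
lemma integral_le_zero [IsProbabilityMeasure D] (h : IsSubGamma D X σ a)
    (hX : AEStronglyMeasurable X D) : ∫ z, X z ∂D ≤ 0 := by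
  have hlim : Filter.Tendsto (fun l : ℝ => l * σ ^ 2 / (2 * (1 - a * |l|))
      * Real.exp (l ^ 2 * σ ^ 2 / (2 * (1 - a * |l|)))) (nhdsWithin 0 (Set.Ioi 0)) (nhds 0) := by
    have : ContinuousAt (fun l : ℝ => l * σ ^ 2 / (2 * (1 - a * |l|))
      * Real.exp (l ^ 2 * σ ^ 2 / (2 * (1 - a * |l|)))) 0 := by
      fun_prop (disch := simp)
    simpa using this.tendsto.mono_left nhdsWithin_le_nhds
  refine ge_of_tendsto hlim ?_
  filter_upwards [eventually_mul_lt_one a] with l ⟨hl, hl0⟩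
  have h1 : l * ∫ z, X z ∂D ≤ Real.exp (l ^ 2 * σ ^ 2 / (2 * (1 - a * |l|))) - 1 := by
    refine le_trans ?_ (sub_le_sub_right (h.integral_exp_le hl) 1)
    rw [← integral_const_mul, le_sub_iff_add_le]
    have : ∫ z, (l * X z + 1) ∂D = ∫ z, l * X z ∂D + 1 := by
      rw [integral_add ((h.integrable hX).const_mul l) (integrable_const _)]
      simp
    rw [← this]
    exact integral_mono (((h.integrable hX).const_mul l).add (integrable_const _))
      (h.integrable_exp hl) fun z => Real.add_one_le_exp _
  have h2 := h1.trans (exp_sub_one_le_mul_exp _)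
  rw [← mul_le_mul_iff_right₀ hl0]
  calc _ ≤ _ := h2
    _ = _ := by ring

lemma integral_eq_zero [IsProbabilityMeasure D] (h : IsSubGamma D X σ a)
    (hX : AEStronglyMeasurable X D) : ∫ z, X z ∂D = 0 := by
  have h1 := h.integral_le_zero hX
  have h2 := h.neg.integral_le_zero hX.neg
  rw [integral_neg] at h2
  linarith

/-- Adding the bounds for `l` and `-l` gives `l² 𝔼X² ≤ 2 (exp ψ - 1) ≤ 2ψ exp ψ`, and `2ψ / l²`
tends to `σ²` as `l` decreases to `0`. -/
lemma integral_sq_le [IsProbabilityMeasure D] (h : IsSubGamma D X σ a)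
    (hX : AEStronglyMeasurable X D) : ∫ z, X z ^ 2 ∂D ≤ σ ^ 2 := by
  have hlim : Filter.Tendsto (fun l : ℝ => σ ^ 2 / (1 - a * |l|)
      * Real.exp (l ^ 2 * σ ^ 2 / (2 * (1 - a * |l|)))) (nhdsWithin 0 (Set.Ioi 0))
      (nhds (σ ^ 2)) := by
    have : ContinuousAt (fun l : ℝ => σ ^ 2 / (1 - a * |l|)
      * Real.exp (l ^ 2 * σ ^ 2 / (2 * (1 - a * |l|)))) 0 := by
      fun_prop (disch := simp)
    simpa using this.tendsto.mono_left nhdsWithin_le_nhds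
  refine ge_of_tendsto hlim ?_
  filter_upwards [eventually_mul_lt_one a] with l ⟨hl, hl0⟩
  set ψ := l ^ 2 * σ ^ 2 / (2 * (1 - a * |l|)) with hψ
  have hl' : a * |(-l)| < 1 := by simpa using hl
  have h1 : l ^ 2 * ∫ z, X z ^ 2 ∂D ≤ Real.exp ψ + Real.exp ψ - 2 := by
    have e1 := h.integral_exp_le hl
    have e2 := h.integral_exp_le hl'
    rw [abs_neg, neg_sq] at e2
    have i1 := h.integrable_exp hl
    have i2 := h.integrable_exp hl'
    have : ∫ z, (Real.exp (l * X z) + Real.exp (-l * X z) - 2) ∂D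
        = ∫ z, Real.exp (l * X z) ∂D + ∫ z, Real.exp (-l * X z) ∂D - 2 := by
      have i12 : Integrable (fun z => Real.exp (l * X z) + Real.exp (-l * X z)) D := i1.add i2
      rw [integral_sub i12 (integrable_const _), integral_add i1 i2]
      simp
    refine le_trans ?_ (sub_le_sub_right (add_le_add e1 e2) 2)
    rw [← this, ← integral_const_mul]
    refine integral_mono ((h.integrable_sq hX).const_mul _)
      ((i1.add i2).sub (integrable_const _)) fun z => ?_
    have := sq_le_exp_add_exp_neg_sub_two (l * X z)
    simpa [mul_pow] using this
  have h2 := exp_sub_one_le_mul_exp ψ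
  have hl2 : 0 < l ^ 2 := by positivity
  rw [← mul_le_mul_iff_right₀ hl2]
  calc _ ≤ Real.exp ψ + Real.exp ψ - 2 := h1
    _ ≤ 2 * (ψ * Real.exp ψ) := by linarith
    _ = _ := by
      have : 1 - a * |l| ≠ 0 := by linarith
      rw [hψ]; field_simp

/-- By independence the exponential moment at `l` is the `b`-th power of the one at `l / b`, which
rescales `σ²` to `σ² / b` and `a` to `a / b`. -/
lemma minibatch [IsProbabilityMeasure D] (h : IsSubGamma D X σ a) {b : ℕ} (hb : 1 ≤ b) :
    IsSubGamma (Measure.pi fun _ : Fin b => D) (fun z => 1 / (b : ℝ) * ∑ j, X (z j))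
      (σ / Real.sqrt b) (a / b) := by
  intro l hl
  have hb' : (0 : ℝ) < b := by exact_mod_cast hb
  have hl' : a * |l / b| < 1 := by
    rw [abs_div, abs_of_pos hb']
    calc a * (|l| / b) = a / b * |l| := by ring
      _ < 1 := hl
  have e : (fun z : Fin b → Z => Real.exp (l * (1 / (b : ℝ) * ∑ j, X (z j))))
      = fun z => ∏ j, Real.exp (l / b * X (z j)) := by
    funext z
    rw [← Real.exp_sum, ← Finset.mul_sum]
    congr 1
    ring
  rw [e]
  refine ⟨Integrable.fintype_prod fun _ => h.integrable_exp hl', ?_⟩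
  rw [integral_fintype_prod_eq_pow (μ := D) (fun z => Real.exp (l / b * X z)), Fintype.card_fin,
    Real.log_pow]
  refine (mul_le_mul_of_nonneg_left (h _ hl').2 hb'.le).trans_eq ?_
  have : 1 - a / b * |l| ≠ 0 := by linarith
  have : b - a * |l| ≠ 0 := by
    intro h0
    apply this
    field_simp
    linarith
  rw [abs_div, abs_of_pos hb', div_pow σ, Real.sq_sqrt hb'.le]
  field_simp

end IsSubGamma

/-! ### Maximal inequality -/

/-- The expected maximum of random variables whose absolute values have sub-gamma exponential
moments up to a constant factor. -/
lemma integral_pi_norm_le {Ω ι : Type*} [MeasurableSpace Ω] {μ : Measure Ω}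
    [IsProbabilityMeasure μ] [Fintype ι] [Nonempty ι] {X : Ω → ι → ℝ} {s c K n : ℝ}
    (hs : 0 ≤ s) (hc : 0 ≤ c) (hX : ∀ i, Measurable fun ω => X ω i)
    (hexp : ∀ i, ∀ l : ℝ, 0 < l → c * l < 1 → Integrable (fun ω => Real.exp (l * |X ω i|)) μ ∧
      ∫ ω, Real.exp (l * |X ω i|) ∂μ ≤ K * Real.exp (l ^ 2 * s ^ 2 / (2 * (1 - c * l))))
    (hn : 1 < n) (hK : K * Fintype.card ι ≤ n) :
    Integrable (fun ω => ‖X ω‖) μ ∧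
      ∫ ω, ‖X ω‖ ∂μ ≤ s * Real.sqrt (2 * Real.log n) + c * Real.log n := by
  have hXm : Measurable X := measurable_pi_lambda _ hX
  have hsum : ∀ l : ℝ, 0 < l → ∀ ω, Real.exp (l * ‖X ω‖) ≤ ∑ i, Real.exp (l * |X ω i|) := by
    intro l hl ω
    obtain ⟨i, -, hi⟩ := Finset.exists_max_image Finset.univ (fun i => |X ω i|)
      Finset.univ_nonempty
    have : ‖X ω‖ ≤ |X ω i| := (pi_norm_le_iff_of_nonneg (abs_nonneg _)).mpr
      fun l => hi l (Finset.mem_univ _)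
    calc Real.exp (l * ‖X ω‖) ≤ Real.exp (l * |X ω i|) := by gcongr
      _ ≤ _ := Finset.single_le_sum (f := fun i => Real.exp (l * |X ω i|))
        (fun _ _ => (Real.exp_pos _).le) (Finset.mem_univ i)
  have hint : ∀ l : ℝ, 0 < l → c * l < 1 → Integrable (fun ω => Real.exp (l * ‖X ω‖)) μ := by
    intro l hl hcl
    refine (integrable_finsetSum Finset.univ fun i _ => (hexp i l hl hcl).1).mono'
      (by fun_prop) (ae_of_all _ fun ω => ?_)
    rw [Real.norm_of_nonneg (Real.exp_pos _).le]
    exact hsum l hl ω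
  have hnorm : Integrable (fun ω => ‖X ω‖) μ := by
    obtain ⟨l, hl, hl0⟩ := (IsSubGamma.eventually_mul_lt_one c).exists
    rw [abs_of_pos hl0] at hl
    refine ((hint l hl0 hl).const_mul l⁻¹).mono' (by fun_prop) (ae_of_all _ fun ω => ?_)
    rw [norm_norm, inv_mul_eq_div, le_div_iff₀ hl0]
    linarith [Real.add_one_le_exp (l * ‖X ω‖)]
  refine ⟨hnorm, ?_⟩
  have hlog : 0 < Real.log n := Real.log_pos hn
  -- The exponential of the maximum is at most the sum of the exponentials, so at most `n exp ψ` in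
  -- expectation. Jensen's inequality, in the form of the tangent line of `exp` at `y = log n + ψ`,
  -- takes the logarithm.
  have key : ∀ l : ℝ, 0 < l → c * l < 1 →
      l * ∫ ω, ‖X ω‖ ∂μ ≤ Real.log n + l ^ 2 * s ^ 2 / (2 * (1 - c * l)) := by
    intro l hl hcl
    set ψ := l ^ 2 * s ^ 2 / (2 * (1 - c * l))
    have h1 : ∫ ω, Real.exp (l * ‖X ω‖) ∂μ ≤ Real.exp (Real.log n + ψ) := by
      calc ∫ ω, Real.exp (l * ‖X ω‖) ∂μ ≤ ∫ ω, ∑ i, Real.exp (l * |X ω i|) ∂μ :=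
            integral_mono (hint l hl hcl)
              (integrable_finsetSum _ fun i _ => (hexp i l hl hcl).1) (hsum l hl)
        _ = ∑ i, ∫ ω, Real.exp (l * |X ω i|) ∂μ :=
            integral_finsetSum _ fun i _ => (hexp i l hl hcl).1
        _ ≤ ∑ _i : ι, K * Real.exp ψ := Finset.sum_le_sum fun i _ => (hexp i l hl hcl).2
        _ = K * Fintype.card ι * Real.exp ψ := by
            rw [Finset.sum_const, Finset.card_univ, nsmul_eq_mul]; ring
        _ ≤ n * Real.exp ψ := by gcongr
        _ = _ := by rw [Real.exp_add, Real.exp_log (by linarith)]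
    set y := Real.log n + ψ
    have h2 : ∀ ω, l * ‖X ω‖ ≤ Real.exp (l * ‖X ω‖) * Real.exp (-y) + (y - 1) := by
      intro ω
      rw [← Real.exp_add]
      linarith [Real.add_one_le_exp (l * ‖X ω‖ + -y)]
    have hi : Integrable (fun ω => Real.exp (l * ‖X ω‖) * Real.exp (-y) + (y - 1)) μ :=
      ((hint l hl hcl).mul_const (Real.exp (-y))).add (integrable_const (y - 1))
    have h3 := integral_mono (hnorm.const_mul l) hi h2
    rw [integral_const_mul, integral_add ((hint l hl hcl).mul_const _) (integrable_const _),
      integral_mul_const] at h3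
    simp only [integral_const, probReal_univ, one_smul] at h3
    have h4 : (∫ ω, Real.exp (l * ‖X ω‖) ∂μ) * Real.exp (-y) ≤ 1 := by
      calc _ ≤ Real.exp y * Real.exp (-y) := by gcongr
        _ = 1 := by rw [← Real.exp_add]; simp
    linarith
  -- The optimal `l` divides by `s`, which may be `0`; hence the bound is proved for `s + ε` and `ε`
  -- tends to `0`.
  have hlim : Filter.Tendsto
      (fun ε : ℝ => (s + ε) * Real.sqrt (2 * Real.log n) + c * Real.log n)
      (nhdsWithin 0 (Set.Ioi 0)) (nhds (s * Real.sqrt (2 * Real.log n) + c * Real.log n)) := by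
    have : Continuous
      (fun ε : ℝ => (s + ε) * Real.sqrt (2 * Real.log n) + c * Real.log n) := by fun_prop
    simpa using (this.tendsto 0).mono_left nhdsWithin_le_nhds
  refine ge_of_tendsto hlim ?_
  filter_upwards [self_mem_nhdsWithin] with ε hε
  have hs' : 0 < s + ε := add_pos_of_nonneg_of_pos hs hε
  set s' := s + ε
  set A := Real.sqrt (2 * Real.log n) with hA
  have hA2 : A ^ 2 = 2 * Real.log n := Real.sq_sqrt (by positivity)
  have hA0 : 0 < A := Real.sqrt_pos.mpr (by positivity)
  set r := A / s' with hr
  have hr0 : 0 < r := by positivity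
  have hcr : 0 < 1 + c * r := by positivity
  -- The choice `l = r / (1 + c r)` with `r = √(2 log n) / s'` makes `1 - c l = 1 / (1 + c r)`. Then
  -- `log n / l = log n / r + c log n`, and the remaining two terms are equal, each `s' √(2 log n) /
  -- 2`.
  have hl0 : 0 < r / (1 + c * r) := by positivity
  have hcl : 1 - c * (r / (1 + c * r)) = 1 / (1 + c * r) := by field_simp; ring
  have h1 := key (r / (1 + c * r)) hl0 (by
    have : 0 < 1 - c * (r / (1 + c * r)) := by rw [hcl]; positivity
    linarith)
  rw [hcl] at h1
  have hss : s ^ 2 ≤ s' ^ 2 := by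
    have : s ≤ s' := le_add_of_nonneg_right (le_of_lt hε)
    gcongr
  rw [← mul_le_mul_iff_right₀ hl0]
  refine h1.trans ?_
  have h2 : (r / (1 + c * r)) ^ 2 * s ^ 2 / (2 * (1 / (1 + c * r)))
      = r ^ 2 * s ^ 2 / (2 * (1 + c * r)) := by field_simp
  have h3 : r ^ 2 * s ^ 2 / (2 * (1 + c * r)) ≤ r ^ 2 * s' ^ 2 / (2 * (1 + c * r)) := by gcongr
  have h4 : r * s' = A := by rw [hr]; field_simp
  rw [h2]
  refine (add_le_add_right h3 _).trans_eq ?_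
  have h5 : r ^ 2 * s' ^ 2 = 2 * Real.log n := by rw [← mul_pow, h4, hA2]
  rw [h5]
  have h6 : r / (1 + c * r) * (s' * A) = 2 * Real.log n / (1 + c * r) := by
    rw [← hA2, ← h4]; ring
  rw [mul_add (r / (1 + c * r)), h6]
  field_simp
  ring

/-! ### The risk and the noise of minibatch gradients -/

/-- The deviation of a minibatch gradient from the gradient of the risk. -/
noncomputable def batchNoise {d b : ℕ} {Z : Type*} [MeasurableSpace Z] (D : Measure Z)
    (f : Vec d → Z → ℝ) (x : Vec d) (z : Fin b → Z) : Vec d :=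
  gradient (empiricalRisk f z) x - gradient (risk D f) x

lemma gradient_empiricalRisk {d b : ℕ} {Z : Type*} {f : Vec d → Z → ℝ} {L : ℝ}
    (hf_smooth : ∀ z, IsSmooth L (fun x => f x z))
    (z : Fin b → Z) (x : Vec d) :
    gradient (empiricalRisk f z) x = (1 / (b : ℝ)) • ∑ j, gradient (fun y => f y (z j)) x := by
  refine HasGradientAt.gradient ?_
  rw [hasGradientAt_iff_hasFDerivAt]
  have h := (HasFDerivAt.fun_sum fun j (_ : j ∈ Finset.univ) =>
    ((hf_smooth (z j)).hasGradientAt x).hasFDerivAt).const_mul (1 / (b : ℝ))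
  refine h.congr_fderiv ?_
  rw [map_smul, map_sum]

section

variable {d : ℕ} {Z : Type*} [MeasurableSpace Z] {D : Measure Z} {f : Vec d → Z → ℝ} {L : ℝ}

/-- Each partial derivative is a limit of difference quotients with increments `1 / (n + 1)`, and
these are measurable in `z`. -/
lemma measurable_gradient_right (hf_meas : ∀ x, Measurable (f x))
    (hf_smooth : ∀ z, IsSmooth L (fun x => f x z)) (x : Vec d) :
    Measurable fun z => gradient (fun y => f y z) x := by
  have hk : ∀ k : Fin d, Measurable fun z => gradient (fun y => f y z) x k := by
    intro k
    set v : Vec d := EuclideanSpace.single k 1 with hv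
    have hε : Filter.Tendsto (fun n : ℕ => 1 / ((n : ℝ) + 1)) Filter.atTop
        (nhdsWithin 0 {0}ᶜ) := by
      rw [tendsto_nhdsWithin_iff]
      exact ⟨tendsto_one_div_add_atTop_nhds_zero_nat, .of_forall fun n => by
        simp only [Set.mem_compl_iff, Set.mem_singleton_iff]; positivity⟩
    refine measurable_of_tendsto_metrizable
      (f := fun (n : ℕ) z => (1 / ((n : ℝ) + 1))⁻¹ * (f (x + (1 / ((n : ℝ) + 1)) • v) z - f x z))
      (fun n => ((hf_meas _).sub (hf_meas x)).const_mul _) ?_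
    rw [tendsto_pi_nhds]
    intro z
    have h1 : HasDerivAt (fun t : ℝ => x + t • v) v 0 := by
      simpa using ((hasDerivAt_id (0 : ℝ)).smul_const v).const_add x
    have h0 : HasGradientAt (fun y => f y z) (gradient (fun y => f y z) x) (x + (0 : ℝ) • v) := by
      simpa using (hf_smooth z).hasGradientAt x
    have h2 := h0.hasFDerivAt.comp_hasDerivAt (0 : ℝ) h1
    have h3 := (hasDerivAt_iff_tendsto_slope.mp h2).comp hε
    have e : (InnerProductSpace.toDual ℝ (Vec d)) (gradient (fun y => f y z) x) v
        = gradient (fun y => f y z) x k := by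
      rw [InnerProductSpace.toDual_apply_apply, hv, EuclideanSpace.inner_single_right]
      simp
    rw [e] at h3
    refine h3.congr fun n => ?_
    simp [slope_def_field, div_eq_inv_mul]
  exact (WithLp.measurable_toLp 2 (Fin d → ℝ)).comp (measurable_pi_lambda _ hk)

/-- Joint measurability is needed because gradients are evaluated at random iterates; it follows
from continuity in `x` and measurability in `z`. -/
lemma measurable_gradient_uncurry (hf_meas : ∀ x, Measurable (f x))
    (hf_smooth : ∀ z, IsSmooth L (fun x => f x z)) :
    Measurable fun p : Vec d × Z => gradient (fun y => f y p.2) p.1 :=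
  measurable_uncurry_of_continuous_of_measurable
    (u := fun (x : Vec d) (z : Z) => gradient (fun y => f y z) x)
    (fun z => (hf_smooth z).continuous_gradient)
    (fun x => measurable_gradient_right hf_meas hf_smooth x)

/-- Differentiability of the risk is not yet available here. Only the fact that `gradient (risk D f)
x` is a constant in `z` is used, so there is no circularity with `risk_isSmooth`. -/
lemma integrable_gradient [IsProbabilityMeasure D] {σ a : ℝ} (hf_meas : ∀ x, Measurable (f x))
    (hf_smooth : ∀ z, IsSmooth L (fun x => f x z))
    (hf_subgamma : ∀ (k : Fin d) (x : Vec d),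
      IsSubGamma D (fun z => gradient (fun y => f y z) x k - gradient (risk D f) x k) σ a)
    (x : Vec d) : Integrable (fun z => gradient (fun y => f y z) x) D := by
  have hm := measurable_gradient_right hf_meas hf_smooth x
  refine Integrable.of_eval_piLp fun k => ?_
  have hmk : Measurable fun z => gradient (fun y => f y z) x k := by fun_prop
  have := (hf_subgamma k x).integrable (hmk.sub_const _).aestronglyMeasurable
  exact (this.add (integrable_const (gradient (risk D f) x k))).congr
    (ae_of_all _ fun z => sub_add_cancel _ _)

/-- The risk is smooth, and differentiation passes under the expectation. -/
lemma risk_isSmooth [IsProbabilityMeasure D] (hf_int : ∀ x, Integrable (f x) D)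
    (hf_smooth : ∀ z, IsSmooth L (fun x => f x z))
    (hgrad : ∀ x, Integrable (fun z => gradient (fun y => f y z) x) D) :
    IsSmooth L (risk D f) := by
  set G : Vec d → Vec d := fun x => ∫ z, gradient (fun y => f y z) x ∂D with hG
  -- The quadratic bound is uniform in `z`, so it survives integration. It identifies `G` as the
  -- gradient of the risk without a dominated convergence argument.
  have hbound : ∀ x y, |risk D f y - risk D f x - inner ℝ (G x) (y - x)|
      ≤ L / 2 * ‖y - x‖ ^ 2 := by
    intro x y
    have e1 : inner ℝ (G x) (y - x) = ∫ z, inner ℝ (gradient (fun y => f y z) x) (y - x) ∂D := by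
      rw [real_inner_comm, hG, ← integral_inner (hgrad x)]
      simp_rw [real_inner_comm]
    have e2 : risk D f y - risk D f x - inner ℝ (G x) (y - x)
        = ∫ z, (f y z - f x z - inner ℝ (gradient (fun y => f y z) x) (y - x)) ∂D := by
      have i1 : Integrable (fun z => f y z - f x z) D := (hf_int y).sub (hf_int x)
      rw [integral_sub i1 ((hgrad x).inner_const _), integral_sub (hf_int y) (hf_int x), e1]
      rfl
    rw [e2]
    refine (abs_integral_le_integral_abs).trans ?_
    refine (integral_mono_of_nonneg (ae_of_all _ fun z => abs_nonneg _)
      (integrable_const (L / 2 * ‖y - x‖ ^ 2))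
      (ae_of_all _ fun z => (hf_smooth z).abs_sub_linear_le x y)).trans_eq ?_
    simp
  have hgr : ∀ x, HasGradientAt (risk D f) (G x) x := by
    intro x
    rw [hasGradientAt_iff_isLittleO]
    have h1 : (fun y => risk D f y - risk D f x - inner ℝ (G x) (y - x))
        =O[nhds x] fun y => ‖y - x‖ ^ 2 := by
      refine Asymptotics.IsBigO.of_bound (L / 2) (.of_forall fun y => ?_)
      rw [Real.norm_eq_abs, Real.norm_of_nonneg (by positivity)]
      exact hbound x y
    refine h1.trans_isLittleO ?_
    have h2 : (fun y : Vec d => ‖y - x‖ ^ 2) =o[nhds x] fun y => ‖y - x‖ ^ 1 := by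
      refine Asymptotics.IsLittleO.comp_tendsto
        (Asymptotics.isLittleO_pow_pow (𝕜 := ℝ) one_lt_two) ?_
      have : Continuous fun y : Vec d => ‖y - x‖ := by fun_prop
      simpa using this.tendsto x
    exact (h2.trans_eventuallyEq (.of_forall fun y => by simp)).of_norm_right
  refine ⟨fun x => (hgr x).differentiableAt, fun x y => ?_⟩
  rw [(hgr x).gradient, (hgr y).gradient, hG]
  simp only
  rw [← integral_sub (hgrad x) (hgrad y)]
  refine (norm_integral_le_of_norm_le (integrable_const (L * ‖x - y‖))
    (ae_of_all _ fun z => (hf_smooth z).2 x y)).trans_eq ?_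
  simp

/-! ### Minibatch noise -/

lemma batchNoise_apply {b : ℕ} (hb : 1 ≤ b) (hf_smooth : ∀ z, IsSmooth L (fun x => f x z))
    (x : Vec d) (z : Fin b → Z) (k : Fin d) :
    batchNoise D f x z k = 1 / (b : ℝ) *
      ∑ j, (gradient (fun y => f y (z j)) x k - gradient (risk D f) x k) := by
  have hb' : (b : ℝ) ≠ 0 := by positivity
  unfold batchNoise
  rw [gradient_empiricalRisk hf_smooth]
  simp
  field_simp

lemma measurable_batchNoise {b : ℕ} (hf_meas : ∀ x, Measurable (f x))
    (hf_smooth : ∀ z, IsSmooth L (fun x => f x z)) (hF : IsSmooth L (risk D f)) :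
    Measurable fun p : Vec d × (Fin b → Z) => batchNoise D f p.1 p.2 := by
  unfold batchNoise
  simp_rw [gradient_empiricalRisk hf_smooth]
  have h1 := measurable_gradient_uncurry hf_meas hf_smooth
  have h2 : Measurable (gradient (risk D f)) := hF.continuous_gradient.measurable
  have h3 : ∀ j : Fin b, Measurable fun p : Vec d × (Fin b → Z) =>
      gradient (fun y => f y (p.2 j)) p.1 := fun j =>
    h1.comp (measurable_fst.prodMk ((measurable_pi_apply j).comp measurable_snd))
  exact ((Finset.measurable_sum _ fun j _ => h3 j).const_smul (1 / (b : ℝ))).sub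
    (h2.comp measurable_fst)

lemma isSubGamma_batchNoise [IsProbabilityMeasure D] {b : ℕ} {σ a : ℝ} (hb : 1 ≤ b)
    (hf_smooth : ∀ z, IsSmooth L (fun x => f x z))
    (hf_subgamma : ∀ (k : Fin d) (x : Vec d),
      IsSubGamma D (fun z => gradient (fun y => f y z) x k - gradient (risk D f) x k) σ a)
    (x : Vec d) (k : Fin d) :
    IsSubGamma (Measure.pi fun _ : Fin b => D) (fun z => batchNoise D f x z k)
      (σ / Real.sqrt b) (a / b) := by
  simp_rw [batchNoise_apply hb hf_smooth]
  exact (hf_subgamma k x).minibatch hb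

end

/-! ### The Markov chains of the agents' states -/

lemma transProb_nonneg {pb pt : ℝ} (hpb : 0 ≤ pb) (hpb1 : pb ≤ 1) (hpt : 0 ≤ pt) (hpt1 : pt ≤ 1)
    (u v : Bool) : 0 ≤ transProb pb pt u v := by
  cases u <;> cases v <;> simp [transProb] <;> linarith

/-- The probability of a step of the agents' chains. -/
noncomputable def stepProb {N : ℕ} (pb pt : ℝ) (v w : Fin N → Bool) : ℝ :=
  ∏ i, transProb pb pt (v i) (w i)

/-- The states at the times `s, …, t` are those of `w`. -/
def pathEvent {Ω : Type*} {N : ℕ} (W : ℕ → Ω → Fin N → Bool) (s t : ℕ)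
    (w : ℕ → Fin N → Bool) : Set Ω :=
  {ω | ∀ r, s ≤ r → r ≤ t → W r ω = w r}

/-- The states at the times `s, …, s + n`. -/
def statePath {Ω : Type*} {N : ℕ} (W : ℕ → Ω → Fin N → Bool) (s n : ℕ) (ω : Ω) :
    Fin (n + 1) → Fin N → Bool :=
  fun r => W (s + r) ω

/-- A path over the times `s, …, s + n`, continued arbitrarily. -/
def extendPath {N n : ℕ} (s : ℕ) (p : Fin (n + 1) → Fin N → Bool) : ℕ → Fin N → Bool :=
  fun r => p (Fin.ofNat (n + 1) (r - s))

lemma extendPath_add {N n : ℕ} (s : ℕ) (p : Fin (n + 1) → Fin N → Bool) (r : Fin (n + 1)) :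
    extendPath s p (s + r) = p r := by
  unfold extendPath
  congr 1
  ext
  simp

lemma setOf_statePath_eq {Ω : Type*} {N n : ℕ} (W : ℕ → Ω → Fin N → Bool) (s : ℕ)
    (p : Fin (n + 1) → Fin N → Bool) :
    {ω | statePath W s n ω = p} = pathEvent W s (s + n) (extendPath s p) := by
  ext ω
  constructor
  · rintro rfl r hr hrn
    obtain ⟨k, rfl⟩ := Nat.exists_eq_add_of_le hr
    exact (extendPath_add s (statePath W s n ω) ⟨k, by omega⟩).symm
  · intro h
    funext r
    rw [← extendPath_add s p r]
    exact h _ (by omega) (by omega)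

lemma integral_eq_sum_fiber {Ω α : Type*} [MeasurableSpace Ω] [Fintype α] {μ : Measure Ω}
    {V : Ω → α} (hV : ∀ w, MeasurableSet {ω | V ω = w}) {Y : Ω → ℝ} (hY : Integrable Y μ) :
    ∫ ω, Y ω ∂μ = ∑ w, ∫ ω in {ω | V ω = w}, Y ω ∂μ := by
  classical
  have e : ∀ ω, Y ω = ∑ w, Set.indicator {ω | V ω = w} Y ω := by
    intro ω
    simp [Set.indicator_apply]
  calc ∫ ω, Y ω ∂μ = ∫ ω, ∑ w, Set.indicator {ω | V ω = w} Y ω ∂μ := by simp_rw [← e]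
    _ = ∑ w, ∫ ω, Set.indicator {ω | V ω = w} Y ω ∂μ :=
        integral_finsetSum _ fun w _ => hY.indicator (hV w)
    _ = _ := by simp_rw [integral_indicator (hV _)]

section

variable {Ω Z : Type*} [mΩ : MeasurableSpace Ω] [MeasurableSpace Z] {N b : ℕ}
  {μ : Measure Ω} [IsProbabilityMeasure μ] {ℱ : Filtration ℕ mΩ} {D : Measure Z} {pb pt : ℝ}
  {W : ℕ → Ω → Fin N → Bool} {ζ : ℕ → Ω → Fin N → Fin b → Z}

namespace IsSASetting

omit [IsProbabilityMeasure μ] in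
lemma measurableSet_state (h : IsSASetting μ ℱ D pb pt W ζ) {t : ℕ} (ht : 1 ≤ t)
    (w : Fin N → Bool) : MeasurableSet[ℱ t] {ω | W t ω = w} :=
  h.measurable_state t ht (measurableSet_singleton w)

omit [IsProbabilityMeasure μ] in
lemma measurableSet_pathEvent (h : IsSASetting μ ℱ D pb pt W ζ) {s t : ℕ} (hs : 1 ≤ s)
    (w : ℕ → Fin N → Bool) : MeasurableSet[ℱ t] (pathEvent W s t w) := by
  have : pathEvent W s t w = ⋂ r, ⋂ (_ : s ≤ r), ⋂ (_ : r ≤ t), {ω | W r ω = w r} := by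
    ext; simp [pathEvent]
  rw [this]
  exact MeasurableSet.iInter fun r => MeasurableSet.iInter fun hr => MeasurableSet.iInter fun hrt =>
    ℱ.mono hrt _ (h.measurableSet_state (hs.trans hr) _)

/-- `Y` times the indicator of the path up to `t` is known at time `t`, so it can be taken out of
the conditional expectation of the next state. On that path the transition probability is a
constant. -/
lemma setIntegral_pathEvent_succ (h : IsSASetting μ ℱ D pb pt W ζ) {s t : ℕ} (hs : 1 ≤ s)
    (hst : s ≤ t) (w : ℕ → Fin N → Bool) {Y : Ω → ℝ} (hY : StronglyMeasurable[ℱ t] Y)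
    (hYi : Integrable Y μ) :
    ∫ ω in pathEvent W s (t + 1) w, Y ω ∂μ
      = stepProb pb pt (w t) (w (t + 1)) * ∫ ω in pathEvent W s t w, Y ω ∂μ := by
  set E := pathEvent W s t w with hE
  set A := {ω | W (t + 1) ω = w (t + 1)} with hA
  have hEm : MeasurableSet[ℱ t] E := h.measurableSet_pathEvent hs w
  have hEm' : MeasurableSet E := ℱ.le t _ hEm
  have hAm : MeasurableSet A := ℱ.le _ _ (h.measurableSet_state (by omega) _)
  have hEA : pathEvent W s (t + 1) w = E ∩ A := by
    ext ω
    constructor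
    · exact fun H => ⟨fun r h1 h2 => H r h1 (by omega), H (t + 1) (by omega) le_rfl⟩
    · rintro ⟨H1, H2⟩ r h1 h2
      rcases Nat.lt_or_ge t r with h3 | h3
      · obtain rfl : r = t + 1 := by omega
        exact H2
      · exact H1 r h1 h3
  have hYE : StronglyMeasurable[ℱ t] (E.indicator Y) := hY.indicator hEm
  have hYEi : Integrable (E.indicator Y) μ := hYi.indicator hEm'
  have hprod : E.indicator Y * A.indicator (fun _ => (1 : ℝ)) = (E ∩ A).indicator Y := by
    funext ω
    simp only [Pi.mul_apply, Set.indicator_apply]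
    by_cases h1 : ω ∈ E <;> by_cases h2 : ω ∈ A <;> simp [h1, h2]
  have hpull := condExp_mul_of_stronglyMeasurable_left (μ := μ) (m := ℱ t) hYE
    (by rw [hprod]; exact hYi.indicator (hEm'.inter hAm))
    ((integrable_const (1 : ℝ)).indicator hAm)
  rw [hEA, ← integral_indicator (hEm'.inter hAm), ← hprod, ← integral_condExp (ℱ.le t),
    integral_congr_ae hpull, ← integral_indicator hEm', ← integral_const_mul]
  refine integral_congr_ae ?_
  filter_upwards [h.markov t (hs.trans hst) (w (t + 1))] with ω hω
  rw [Pi.mul_apply, hω]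
  by_cases hωE : ω ∈ E
  · have : W t ω = w t := hωE t hst le_rfl
    rw [Set.indicator_of_mem hωE, this, stepProb, mul_comm]
  · rw [Set.indicator_of_notMem hωE, zero_mul, mul_zero]

/-- Given the past up to time `u`, the states after `u` follow the chains. -/
lemma setIntegral_pathEvent (h : IsSASetting μ ℱ D pb pt W ζ) {s u : ℕ} (hs : 1 ≤ s)
    (hsu : s ≤ u) (w : ℕ → Fin N → Bool) {Y : Ω → ℝ} (hY : StronglyMeasurable[ℱ u] Y)
    (hYi : Integrable Y μ) (k : ℕ) :
    ∫ ω in pathEvent W s (u + k) w, Y ω ∂μ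
      = (∏ r ∈ Finset.range k, stepProb pb pt (w (u + r)) (w (u + r + 1)))
        * ∫ ω in pathEvent W s u w, Y ω ∂μ := by
  induction k with
  | zero => simp
  | succ k ih =>
    rw [← add_assoc, h.setIntegral_pathEvent_succ hs (by omega) w
      (hY.mono (ℱ.mono (Nat.le_add_right u k))) hYi, ih, Finset.prod_range_succ]
    ring

omit [IsProbabilityMeasure μ] in
lemma measurableSet_statePath (h : IsSASetting μ ℱ D pb pt W ζ) {s : ℕ} (hs : 1 ≤ s) {n : ℕ}
    (p : Fin (n + 1) → Fin N → Bool) : MeasurableSet {ω | statePath W s n ω = p} := by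
  rw [setOf_statePath_eq]
  exact ℱ.le _ _ (h.measurableSet_pathEvent hs _)

/-- If the conditional expectation of `Y` given the past of time `u` and the states at time `u` is
nonpositive, then so is its integral over any event given by the states in a time window. -/
lemma setIntegral_statePath_nonpos (h : IsSASetting μ ℱ D pb pt W ζ) (hpb : 0 ≤ pb)
    (hpb1 : pb ≤ 1) (hpt : 0 ≤ pt) (hpt1 : pt ≤ 1) {s n u : ℕ} (hs : 1 ≤ s) (hsu : s ≤ u)
    (hun : u ≤ s + n) {Y : Ω → ℝ} (hY : StronglyMeasurable[ℱ u] Y) (hYi : Integrable Y μ)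
    (hneg : ∀ A, MeasurableSet[ℱ (u - 1) ⊔ MeasurableSpace.comap (W u) inferInstance] A →
      ∫ ω in A, Y ω ∂μ ≤ 0)
    (p : Fin (n + 1) → Fin N → Bool) : ∫ ω in {ω | statePath W s n ω = p}, Y ω ∂μ ≤ 0 := by
  -- The `k` states after `u` contribute only a nonnegative constant factor. The event that remains
  -- involves states up to time `u`, so it lies in the sigma-algebra of `hneg`.
  obtain ⟨k, hk⟩ := Nat.exists_eq_add_of_le hun
  rw [setOf_statePath_eq, hk, h.setIntegral_pathEvent hs hsu _ hY hYi k]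
  refine mul_nonpos_of_nonneg_of_nonpos
    (Finset.prod_nonneg fun r _ => Finset.prod_nonneg fun i _ =>
      transProb_nonneg hpb hpb1 hpt hpt1 _ _) (hneg _ ?_)
  set w := extendPath s p
  have : pathEvent W s u w
      = (⋂ r, ⋂ (_ : s ≤ r), ⋂ (_ : r < u), {ω | W r ω = w r}) ∩ {ω | W u ω = w u} := by
    ext ω
    simp only [pathEvent, Set.mem_ofPred_eq, Set.mem_inter_iff, Set.mem_iInter]
    constructor
    · exact fun H => ⟨fun r h1 h2 => H r h1 h2.le, H u hsu le_rfl⟩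
    · rintro ⟨H1, H2⟩ r h1 h2
      rcases h2.eq_or_lt with rfl | h3
      · exact H2
      · exact H1 r h1 h3
  rw [this]
  refine MeasurableSet.inter ?_ ?_
  · refine (le_sup_left : ℱ (u - 1) ≤ _) _ ?_
    exact MeasurableSet.iInter fun r => MeasurableSet.iInter fun hr => MeasurableSet.iInter
      fun hrt => ℱ.mono (by omega : r ≤ u - 1) _ (h.measurableSet_state (hs.trans hr) _)
  · exact (le_sup_right : MeasurableSpace.comap (W u) inferInstance ≤ _) _
      ⟨{w u}, measurableSet_singleton _, rfl⟩

/-- The case in which `Y` is known at the start of the window; the transition products that split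
off are the weights in `failProb`. -/
lemma setIntegral_statePath (h : IsSASetting μ ℱ D pb pt W ζ) {s n : ℕ} (hs : 1 ≤ s)
    {Y : Ω → ℝ} (hY : StronglyMeasurable[ℱ s] Y) (hYi : Integrable Y μ)
    (p : Fin (n + 1) → Fin N → Bool) :
    ∫ ω in {ω | statePath W s n ω = p}, Y ω ∂μ
      = (∏ r : Fin n, ∏ i, transProb pb pt (p r.castSucc i) (p r.succ i))
        * ∫ ω in {ω | W s ω = p 0}, Y ω ∂μ := by
  rw [setOf_statePath_eq, h.setIntegral_pathEvent hs le_rfl _ hY hYi n, Finset.prod_range]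
  congr 1
  · refine Finset.prod_congr rfl fun r _ => ?_
    have h1 := extendPath_add s p r.castSucc
    have h2 := extendPath_add s p r.succ
    simp only [Fin.val_castSucc, Fin.val_succ] at h1 h2
    rw [h1, add_assoc, h2, stepProb]
  · have : pathEvent W s s (extendPath s p) = {ω | W s ω = p 0} := by
      have h0 := extendPath_add s p 0
      ext ω
      simp only [pathEvent, Set.mem_ofPred_eq]
      simp only [Fin.val_zero, add_zero] at h0
      constructor
      · intro H
        rw [← h0]
        exact H s le_rfl le_rfl
      · intro H r h1 h2
        obtain rfl : r = s := by omega
        rw [H, h0]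
    rw [this]

end IsSASetting

/-! ### Probability of failed aggregation -/

lemma failProb_nonneg {m m₀ : ℕ} {α₁ α₂ : ℝ} (hpb : 0 ≤ pb) (hpb1 : pb ≤ 1)
    (hpt : 0 ≤ pt) (hpt1 : pt ≤ 1) (w : Fin N → Bool) : 0 ≤ failProb m m₀ N α₁ α₂ pb pt w := by
  refine Finset.sum_nonneg fun q _ => ?_
  split_ifs
  · exact Finset.prod_nonneg fun r _ => Finset.prod_nonneg fun i _ =>
      transProb_nonneg hpb hpb1 hpt hpt1 _ _
  · exact le_rfl

lemma failProb_le_PZ (m m₀ : ℕ) (α₁ α₂ pb pt : ℝ) (w : Fin N → Bool) :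
    failProb m m₀ N α₁ α₂ pb pt w ≤ PZ m m₀ N α₁ α₂ pb pt :=
  le_ciSup (Set.finite_range _).bddAbove w

lemma PZ_nonneg {m m₀ : ℕ} {α₁ α₂ : ℝ} (hpb : 0 ≤ pb) (hpb1 : pb ≤ 1)
    (hpt : 0 ≤ pt) (hpt1 : pt ≤ 1) : 0 ≤ PZ m m₀ N α₁ α₂ pb pt :=
  (failProb_nonneg hpb hpb1 hpt hpt1 (fun _ => false)).trans (failProb_le_PZ _ _ _ _ _ _ _)

/-- The event that robust aggregation fails at time `s + m₀ + m - 1`. -/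
def failEvent (W : ℕ → Ω → Fin N → Bool) (m m₀ s : ℕ) (α₁ α₂ : ℝ) : Set Ω :=
  {ω | AggregationFails m m₀ α₁ α₂ (statePath W s (m₀ + m - 1) ω)}

namespace IsSASetting

omit [IsProbabilityMeasure μ] in
lemma measurableSet_failEvent (h : IsSASetting μ ℱ D pb pt W ζ) {s : ℕ} (hs : 1 ≤ s)
    (m m₀ : ℕ) (α₁ α₂ : ℝ) : MeasurableSet (failEvent W m m₀ s α₁ α₂) := by
  have : failEvent W m m₀ s α₁ α₂ = ⋃ p, ⋃ (_ : AggregationFails m m₀ α₁ α₂ p),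
      {ω | statePath W s (m₀ + m - 1) ω = p} := by
    ext ω; simp [failEvent]
  rw [this]
  exact MeasurableSet.iUnion fun p => MeasurableSet.iUnion fun _ => h.measurableSet_statePath hs p

/-- Failure of robust aggregation is unlikely given the information `m₀ + m - 1` steps earlier. -/
lemma setIntegral_failEvent_le (h : IsSASetting μ ℱ D pb pt W ζ) {s : ℕ} (hs : 1 ≤ s)
    (m m₀ : ℕ) (α₁ α₂ : ℝ) {Y : Ω → ℝ} (hY : StronglyMeasurable[ℱ s] Y)
    (hYi : Integrable Y μ) (hY0 : ∀ ω, 0 ≤ Y ω) :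
    ∫ ω in failEvent W m m₀ s α₁ α₂, Y ω ∂μ ≤ PZ m m₀ N α₁ α₂ pb pt * ∫ ω, Y ω ∂μ := by
  classical
  set n := m₀ + m - 1 with hn
  have hS : ∀ w, MeasurableSet {ω | W s ω = w} := fun w => ℱ.le _ _ (h.measurableSet_state hs w)
  have hF := h.measurableSet_failEvent hs m m₀ α₁ α₂
  have hP := fun p => h.measurableSet_statePath hs (n := n) p
  have h1 : ∀ p : Fin (n + 1) → Fin N → Bool,
      ∫ ω in {ω | statePath W s n ω = p}, (failEvent W m m₀ s α₁ α₂).indicator Y ω ∂μ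
        = if AggregationFails m m₀ α₁ α₂ p then
          (∏ r : Fin n, ∏ i, transProb pb pt (p r.castSucc i) (p r.succ i))
            * ∫ ω in {ω | W s ω = p 0}, Y ω ∂μ else 0 := by
    intro p
    split_ifs with hp
    · rw [← h.setIntegral_statePath hs hY hYi p]
      refine setIntegral_congr_fun (hP p) fun ω hω => ?_
      refine Set.indicator_of_mem ?_ _
      change AggregationFails m m₀ α₁ α₂ (statePath W s n ω)
      rwa [show statePath W s n ω = p from hω]
    · rw [← integral_zero Ω ℝ (μ := μ.restrict {ω | statePath W s n ω = p})]
      refine setIntegral_congr_fun (hP p) fun ω hω => ?_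
      refine Set.indicator_of_notMem ?_ _
      change ¬ AggregationFails m m₀ α₁ α₂ (statePath W s n ω)
      rwa [show statePath W s n ω = p from hω]
  -- A path is split into its initial state and its continuation. For each initial state the sum
  -- over continuations is `failProb`, which is at most `PZ`.
  rw [← integral_indicator hF, integral_eq_sum_fiber hP (hYi.indicator hF),
    Finset.sum_congr rfl fun p _ => h1 p,
    ← (Fin.consEquiv fun _ : Fin (n + 1) => Fin N → Bool).sum_comp, Fintype.sum_prod_type,
    integral_eq_sum_fiber hS hYi, Finset.mul_sum]
  refine Finset.sum_le_sum fun w _ => ?_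
  refine le_trans (le_of_eq ?_) (mul_le_mul_of_nonneg_right (failProb_le_PZ m m₀ α₁ α₂ pb pt w)
    (integral_nonneg hY0))
  rw [failProb, Finset.sum_mul]
  refine Finset.sum_congr rfl fun q _ => ?_
  simp only [Fin.consEquiv_apply, Fin.cons_zero, ite_mul, zero_mul]
  rfl

end IsSASetting

end

/-! ### Fresh samples -/

section

variable {Ω Z β : Type*} [mΩ : MeasurableSpace Ω] [MeasurableSpace Z] [MeasurableSpace β]
  {N b : ℕ} {μ : Measure Ω} [IsProbabilityMeasure μ] {ℱ : Filtration ℕ mΩ} {D : Measure Z}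
  [IsProbabilityMeasure D] {pb pt : ℝ} {W : ℕ → Ω → Fin N → Bool}
  {ζ : ℕ → Ω → Fin N → Fin b → Z}

namespace IsSASetting

/-- The law of all samples of one iteration. -/
local notation "π" => Measure.pi fun _ : Fin N => Measure.pi fun _ : Fin b => D

omit [IsProbabilityMeasure μ] [IsProbabilityMeasure D] in
lemma sup_le (h : IsSASetting μ ℱ D pb pt W ζ) {t : ℕ} (ht : 1 ≤ t) :
    ℱ (t - 1) ⊔ MeasurableSpace.comap (W t) inferInstance ≤ ℱ t :=
  _root_.sup_le (ℱ.mono (Nat.sub_le t 1)) (h.measurable_state t ht).comap_le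

omit [IsProbabilityMeasure D] in
-- Whatever is known before the samples of time `t` are drawn, including the states at time `t`, is
-- independent of them; the joint law is a product and Fubini's theorem applies.
lemma map_prod (h : IsSASetting μ ℱ D pb pt W ζ) {t : ℕ} (ht : 1 ≤ t) {X : Ω → β}
    (hX : Measurable[ℱ (t - 1) ⊔ MeasurableSpace.comap (W t) inferInstance] X) :
    μ.map (fun ω => (X ω, ζ t ω)) = (μ.map X).prod π := by
  have hX' : Measurable X := hX.mono ((h.sup_le ht).trans (ℱ.le t)) le_rfl
  have hζ : Measurable (ζ t) := (h.measurable_sample t ht).mono (ℱ.le t) le_rfl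
  have hind : IndepFun X (ζ t) μ := by
    rw [IndepFun_iff_Indep]
    exact indep_of_indep_of_le_left (h.sample_indep t ht).symm hX.comap_le
  rw [(indepFun_iff_map_prod_eq_prod_map_map hX'.aemeasurable hζ.aemeasurable).mp hind,
    h.sample_law t ht]

/-- Averaging out the samples first. -/
lemma integral_sample_nonpos (h : IsSASetting μ ℱ D pb pt W ζ) {t : ℕ} (ht : 1 ≤ t) {X : Ω → β}
    (hX : Measurable[ℱ (t - 1) ⊔ MeasurableSpace.comap (W t) inferInstance] X)
    {φ : β × (Fin N → Fin b → Z) → ℝ} (hφ : Measurable φ)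
    (hint : Integrable (fun ω => φ (X ω, ζ t ω)) μ) (hneg : ∀ ω, ∫ z, φ (X ω, z) ∂π ≤ 0) :
    ∫ ω, φ (X ω, ζ t ω) ∂μ ≤ 0 := by
  have hX' : Measurable X := hX.mono ((h.sup_le ht).trans (ℱ.le t)) le_rfl
  have hζ : Measurable (ζ t) := (h.measurable_sample t ht).mono (ℱ.le t) le_rfl
  have hm : AEMeasurable (fun ω => (X ω, ζ t ω)) μ := (hX'.prodMk hζ).aemeasurable
  have hprob : IsProbabilityMeasure (μ.map X) := Measure.isProbabilityMeasure_map hX'.aemeasurable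
  have hi : Integrable φ ((μ.map X).prod π) := by
    rw [← h.map_prod ht hX]
    exact (integrable_map_measure hφ.aestronglyMeasurable hm).mpr hint
  rw [← integral_map hm hφ.aestronglyMeasurable, h.map_prod ht hX, integral_prod _ hi,
    integral_map hX'.aemeasurable hi.integral_prod_left.aestronglyMeasurable]
  exact integral_nonpos hneg

/-- A nonnegative function of the past and of fresh samples whose mean given the past is
bounded. -/
lemma integral_sample_le (h : IsSASetting μ ℱ D pb pt W ζ) {t : ℕ} (ht : 1 ≤ t) {X : Ω → β}
    (hX : Measurable[ℱ (t - 1) ⊔ MeasurableSpace.comap (W t) inferInstance] X)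
    {φ : β × (Fin N → Fin b → Z) → ℝ} (hφ : Measurable φ) (hφ0 : ∀ p, 0 ≤ φ p) {C : ℝ}
    (hi : ∀ x, Integrable (fun z => φ (x, z)) π) (hC : ∀ x, ∫ z, φ (x, z) ∂π ≤ C) :
    Integrable (fun ω => φ (X ω, ζ t ω)) μ ∧ ∫ ω, φ (X ω, ζ t ω) ∂μ ≤ C := by
  have hX' : Measurable X := hX.mono ((h.sup_le ht).trans (ℱ.le t)) le_rfl
  have hζ : Measurable (ζ t) := (h.measurable_sample t ht).mono (ℱ.le t) le_rfl
  have hm : AEMeasurable (fun ω => (X ω, ζ t ω)) μ := (hX'.prodMk hζ).aemeasurable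
  have hprob : IsProbabilityMeasure (μ.map X) := Measure.isProbabilityMeasure_map hX'.aemeasurable
  have hint : Integrable φ ((μ.map X).prod π) := by
    rw [integrable_prod_iff hφ.aestronglyMeasurable]
    refine ⟨ae_of_all _ hi, ?_⟩
    refine (integrable_const C).mono' ?_ (ae_of_all _ fun x => ?_)
    · exact hφ.norm.stronglyMeasurable.integral_prod_right'.aestronglyMeasurable
    · simp_rw [Real.norm_of_nonneg (hφ0 _)]
      rw [Real.norm_of_nonneg (integral_nonneg fun z => hφ0 _)]
      exact hC x
  constructor
  · rw [← h.map_prod ht hX] at hint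
    exact (integrable_map_measure hφ.aestronglyMeasurable hm).mp hint
  · rw [← integral_map hm hφ.aestronglyMeasurable, h.map_prod ht hX, integral_prod _ hint]
    refine (integral_mono hint.integral_prod_left (integrable_const C) hC).trans_eq ?_
    simp

section

variable {φ : β → (Fin b → Z) → ℝ} {X : ℕ → Ω → β} {s c : ℝ}

/-- Sub-gamma noise of fresh samples is sub-gamma. -/
lemma isSubGamma_sample (h : IsSASetting μ ℱ D pb pt W ζ)
    (hφ : Measurable fun p : β × (Fin b → Z) => φ p.1 p.2)
    (hsub : ∀ x, IsSubGamma (Measure.pi fun _ : Fin b => D) (φ x) s c)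
    {t : ℕ} (ht : 1 ≤ t) (hX : Measurable[ℱ (t - 1)] (X t)) (i : Fin N) :
    IsSubGamma μ (fun ω => φ (X t ω) (ζ t ω i)) s c := by
  intro l hl
  have key := h.integral_sample_le ht (hX.mono le_sup_left le_rfl)
    (φ := fun p => Real.exp (l * φ p.1 (p.2 i)))
    (C := Real.exp (l ^ 2 * s ^ 2 / (2 * (1 - c * |l|))))
    (Real.measurable_exp.comp ((hφ.comp (measurable_fst.prodMk
      ((measurable_pi_apply i).comp measurable_snd))).const_mul l))
    (fun p => (Real.exp_pos _).le)
    (fun x => integrable_comp_eval (μ := fun _ : Fin N => Measure.pi fun _ : Fin b => D)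
      ((hsub x).integrable_exp hl))
    (fun x => by
      refine le_trans (le_of_eq ?_) ((hsub x).integral_exp_le hl)
      exact integral_comp_eval (μ := fun _ : Fin N => Measure.pi fun _ : Fin b => D) (i := i)
        ((hsub x).integrable_exp hl).aestronglyMeasurable)
  refine ⟨key.1, ?_⟩
  rw [Real.log_le_iff_le_exp (integral_exp_pos key.1)]
  exact key.2

omit [IsProbabilityMeasure μ] [IsProbabilityMeasure D] in
lemma measurable_sample_noise (h : IsSASetting μ ℱ D pb pt W ζ)
    (hφ : Measurable fun p : β × (Fin b → Z) => φ p.1 p.2)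
    {t : ℕ} (ht : 1 ≤ t) (hX : Measurable[ℱ (t - 1)] (X t)) (i : Fin N) :
    Measurable[ℱ t] fun ω => φ (X t ω) (ζ t ω i) :=
  hφ.comp (Measurable.prodMk (hX.mono (ℱ.mono (Nat.sub_le t 1)) le_rfl)
    ((measurable_pi_apply i).comp (h.measurable_sample t ht)))

lemma memLp_sample (h : IsSASetting μ ℱ D pb pt W ζ)
    (hφ : Measurable fun p : β × (Fin b → Z) => φ p.1 p.2)
    (hsub : ∀ x, IsSubGamma (Measure.pi fun _ : Fin b => D) (φ x) s c)
    {t : ℕ} (ht : 1 ≤ t) (hX : Measurable[ℱ (t - 1)] (X t)) (i : Fin N) :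
    MemLp (fun ω => φ (X t ω) (ζ t ω i)) 2 μ :=
  (h.isSubGamma_sample hφ hsub ht hX i).memLp_two
    ((h.measurable_sample_noise hφ ht hX i).mono (ℱ.le t) le_rfl).aestronglyMeasurable

omit [MeasurableSpace β] [IsProbabilityMeasure D] in
lemma integral_pi_mul_eq_zero [IsProbabilityMeasure D] {u v : (Fin b → Z) → ℝ}
    (hu : ∫ z, u z ∂(Measure.pi fun _ : Fin b => D) = 0) {i j : Fin N} (hij : i ≠ j) :
    ∫ z, u (z i) * v (z j) ∂π = 0 := by
  classical
  set w : Fin N → (Fin b → Z) → ℝ := fun l => if l = i then u else if l = j then v else 1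
  have e : ∀ z : Fin N → Fin b → Z, u (z i) * v (z j) = ∏ l, w l (z l) := by
    intro z
    rw [Finset.prod_eq_mul i j hij]
    · simp [w, hij.symm]
    · rintro l - ⟨h1, h2⟩
      simp [w, h1, h2]
    · simp
    · simp
  simp_rw [e]
  rw [integral_fintype_prod_eq_prod]
  exact Finset.prod_eq_zero (Finset.mem_univ i) (by simpa [w] using hu)

/-- Conditional second moments of the noise. -/
lemma setIntegral_sample_sq_sub_nonpos (h : IsSASetting μ ℱ D pb pt W ζ)
    (hφ : Measurable fun p : β × (Fin b → Z) => φ p.1 p.2)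
    (hsub : ∀ x, IsSubGamma (Measure.pi fun _ : Fin b => D) (φ x) s c)
    {t : ℕ} (ht : 1 ≤ t) (hX : Measurable[ℱ (t - 1)] (X t)) (i : Fin N) {A : Set Ω}
    (hA : MeasurableSet[ℱ (t - 1) ⊔ MeasurableSpace.comap (W t) inferInstance] A) :
    ∫ ω in A, (φ (X t ω) (ζ t ω i) ^ 2 - s ^ 2) ∂μ ≤ 0 := by
  have hA' : MeasurableSet A := (h.sup_le ht).trans (ℱ.le t) _ hA
  have hφi : Measurable fun p : (β × ℝ) × (Fin N → Fin b → Z) => φ p.1.1 (p.2 i) :=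
    hφ.comp ((measurable_fst.comp measurable_fst).prodMk
      ((measurable_pi_apply i).comp measurable_snd))
  have e : ∀ ω, A.indicator (fun ω => φ (X t ω) (ζ t ω i) ^ 2 - s ^ 2) ω
      = A.indicator (fun _ => (1 : ℝ)) ω * (φ (X t ω) (ζ t ω i) ^ 2 - s ^ 2) := by
    intro ω
    by_cases hω : ω ∈ A <;> simp [hω]
  have hi : Integrable (fun ω => φ (X t ω) (ζ t ω i) ^ 2 - s ^ 2) μ :=
    (h.memLp_sample hφ hsub ht hX i).integrable_sq.sub (integrable_const _)
  rw [← integral_indicator hA']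
  have hi' := hi.indicator hA'
  -- The indicator of `A` is adjoined to `X t` as a further coordinate known before the samples. The
  -- set integral thereby becomes an integral to which `integral_sample_nonpos` applies.
  simp_rw [e]
  refine h.integral_sample_nonpos ht
    (X := fun ω => (X t ω, A.indicator (fun _ => (1 : ℝ)) ω))
    (φ := fun p => p.1.2 * (φ p.1.1 (p.2 i) ^ 2 - s ^ 2))
    ((hX.mono le_sup_left le_rfl).prodMk (measurable_const.indicator hA))
    ((measurable_snd.comp measurable_fst).mul ((hφi.pow_const 2).sub_const _))
    (hi'.congr (ae_of_all _ e)) fun ω => ?_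
  simp only
  rw [integral_const_mul]
  refine mul_nonpos_of_nonneg_of_nonpos (Set.indicator_nonneg (fun _ _ => zero_le_one) _) ?_
  have hφx : Measurable (φ (X t ω)) := hφ.comp measurable_prodMk_left
  have hsq := (hsub (X t ω)).integrable_sq hφx.aestronglyMeasurable
  have e2 := integral_comp_eval (μ := fun _ : Fin N => Measure.pi fun _ : Fin b => D) (i := i)
    (f := fun z => φ (X t ω) z ^ 2) hsq.aestronglyMeasurable
  rw [integral_sub (integrable_comp_eval (μ := fun _ : Fin N => Measure.pi fun _ : Fin b => D)
    (i := i) hsq) (integrable_const _), e2]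
  have := (hsub (X t ω)).integral_sq_le hφx.aestronglyMeasurable
  simpa using this

/-- Noises of different agents in the same iteration are conditionally uncorrelated. -/
lemma setIntegral_sample_mul_nonpos (h : IsSASetting μ ℱ D pb pt W ζ)
    (hφ : Measurable fun p : β × (Fin b → Z) => φ p.1 p.2)
    (hsub : ∀ x, IsSubGamma (Measure.pi fun _ : Fin b => D) (φ x) s c)
    {t : ℕ} (ht : 1 ≤ t) (hX : Measurable[ℱ (t - 1)] (X t)) {i j : Fin N} (hij : i ≠ j)
    (ε : ℝ) {A : Set Ω}
    (hA : MeasurableSet[ℱ (t - 1) ⊔ MeasurableSpace.comap (W t) inferInstance] A) :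
    ∫ ω in A, ε * (φ (X t ω) (ζ t ω i) * φ (X t ω) (ζ t ω j)) ∂μ ≤ 0 := by
  have hA' : MeasurableSet A := (h.sup_le ht).trans (ℱ.le t) _ hA
  have hφi : ∀ i, Measurable fun p : (β × ℝ) × (Fin N → Fin b → Z) => φ p.1.1 (p.2 i) :=
    fun i => hφ.comp ((measurable_fst.comp measurable_fst).prodMk
      ((measurable_pi_apply i).comp measurable_snd))
  have e : ∀ ω, A.indicator (fun ω => ε * (φ (X t ω) (ζ t ω i) * φ (X t ω) (ζ t ω j))) ω
      = A.indicator (fun _ => ε) ω * (φ (X t ω) (ζ t ω i) * φ (X t ω) (ζ t ω j)) := by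
    intro ω
    by_cases hω : ω ∈ A <;> simp [hω]
  have hi : Integrable (fun ω => ε * (φ (X t ω) (ζ t ω i) * φ (X t ω) (ζ t ω j))) μ :=
    ((h.memLp_sample hφ hsub ht hX i).integrable_mul
      (h.memLp_sample hφ hsub ht hX j)).const_mul ε
  rw [← integral_indicator hA']
  have hi' := hi.indicator hA'
  simp_rw [e]
  refine h.integral_sample_nonpos ht
    (X := fun ω => (X t ω, A.indicator (fun _ => ε) ω))
    (φ := fun p => p.1.2 * (φ p.1.1 (p.2 i) * φ p.1.1 (p.2 j)))
    ((hX.mono le_sup_left le_rfl).prodMk (measurable_const.indicator hA))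
    ((measurable_snd.comp measurable_fst).mul ((hφi i).mul (hφi j)))
    (hi'.congr (ae_of_all _ e)) fun ω => ?_
  simp only
  have hφx : Measurable (φ (X t ω)) := hφ.comp measurable_prodMk_left
  rw [integral_const_mul, integral_pi_mul_eq_zero
    ((hsub (X t ω)).integral_eq_zero hφx.aestronglyMeasurable) hij, mul_zero]

/-- The noise is conditionally centred given the past. -/
lemma setIntegral_past_mul_sample_nonpos (h : IsSASetting μ ℱ D pb pt W ζ)
    (hφ : Measurable fun p : β × (Fin b → Z) => φ p.1 p.2)
    (hsub : ∀ x, IsSubGamma (Measure.pi fun _ : Fin b => D) (φ x) s c)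
    {t : ℕ} (ht : 1 ≤ t) (hX : Measurable[ℱ (t - 1)] (X t)) (i : Fin N) {Y : Ω → ℝ}
    (hY : Measurable[ℱ (t - 1)] Y) (hYL : MemLp Y 2 μ) {A : Set Ω}
    (hA : MeasurableSet[ℱ (t - 1) ⊔ MeasurableSpace.comap (W t) inferInstance] A) :
    ∫ ω in A, Y ω * φ (X t ω) (ζ t ω i) ∂μ ≤ 0 := by
  have hA' : MeasurableSet A := (h.sup_le ht).trans (ℱ.le t) _ hA
  have hφi : Measurable fun p : (β × ℝ) × (Fin N → Fin b → Z) => φ p.1.1 (p.2 i) :=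
    hφ.comp ((measurable_fst.comp measurable_fst).prodMk
      ((measurable_pi_apply i).comp measurable_snd))
  have e : ∀ ω, A.indicator (fun ω => Y ω * φ (X t ω) (ζ t ω i)) ω
      = A.indicator Y ω * φ (X t ω) (ζ t ω i) := by
    intro ω
    by_cases hω : ω ∈ A <;> simp [hω]
  have hi : Integrable (fun ω => Y ω * φ (X t ω) (ζ t ω i)) μ :=
    hYL.integrable_mul (h.memLp_sample hφ hsub ht hX i)
  rw [← integral_indicator hA']
  have hi' := hi.indicator hA'
  simp_rw [e]
  refine h.integral_sample_nonpos ht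
    (X := fun ω => (X t ω, A.indicator Y ω))
    (φ := fun p => p.1.2 * φ p.1.1 (p.2 i))
    ((hX.mono le_sup_left le_rfl).prodMk ((hY.mono le_sup_left le_rfl).indicator hA))
    ((measurable_snd.comp measurable_fst).mul hφi)
    (hi'.congr (ae_of_all _ e)) fun ω => ?_
  simp only
  have hφx : Measurable (φ (X t ω)) := hφ.comp measurable_prodMk_left
  have e2 := integral_comp_eval (μ := fun _ : Fin N => Measure.pi fun _ : Fin b => D) (i := i)
    (f := φ (X t ω)) hφx.aestronglyMeasurable
  rw [integral_const_mul, e2, (hsub (X t ω)).integral_eq_zero hφx.aestronglyMeasurable, mul_zero]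

end

end IsSASetting

end

/-! ### The aggregation error for given states and noises -/

lemma EuclideanSpace.norm_le_sqrt_mul {d : ℕ} {v : Vec d} {M : ℝ} (hM : 0 ≤ M)
    (h : ∀ k, |v k| ≤ M) : ‖v‖ ≤ Real.sqrt d * M := by
  rw [EuclideanSpace.norm_eq, Real.sqrt_le_left (by positivity), mul_pow, Real.sq_sqrt (by positivity)]
  calc ∑ k, ‖v k‖ ^ 2 ≤ ∑ _k : Fin d, M ^ 2 := Finset.sum_le_sum fun k _ => by
        rw [Real.norm_eq_abs]; gcongr; exact h k
    _ = d * M ^ 2 := by simp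

lemma EuclideanSpace.abs_apply_le_norm {d : ℕ} (v : Vec d) (k : Fin d) : |v k| ≤ ‖v‖ :=
  PiLp.norm_apply_le v k

/-- The error of the two-stage robust aggregation when the agents of `G` are trustworthy at the
times of `H i`. Here `y τ` are the exact gradients, `ξ i τ` the noises and `y₀` the target. -/
lemma norm_aggregate_sub_le {d N m : ℕ} (hd : 1 ≤ d) (hN : 1 ≤ N) (hm : 1 ≤ m) {α₁ α₂ : ℝ}
    (hα₁0 : 0 ≤ α₁) (hα₁ : α₁ < 1 / 2) (hα₂0 : 0 ≤ α₂) (hα₂ : α₂ < 1 / 2)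
    {v ξ : Fin N → Fin m → Vec d} {u : Fin N → Vec d} {w y₀ : Vec d} {y : Fin m → Vec d}
    (hu : ∀ i, IsRobustMean α₁ (v i) (u i)) (hw : IsRobustMean α₂ u w)
    {G : Finset (Fin N)} {H : Fin N → Finset (Fin m)} (hG : (G.card : ℝ) = (1 - α₂) * N)
    (hH : ∀ i, ((H i).card : ℝ) = (1 - α₁) * m)
    (hv : ∀ i ∈ G, ∀ τ ∈ H i, v i τ = y τ + ξ i τ)
    {δ V B : ℝ} {U : Fin N → ℝ} (hδ : ∀ τ, ‖y τ - y₀‖ ≤ δ) (hU : ∀ i τ k, |ξ i τ k| ≤ U i)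
    (hV : ∀ i τ k, |ξ i τ k| ≤ V)
    (hB : ∀ i k, |1 / ((1 - α₁) * m) * ∑ τ ∈ H i, ξ i τ k| ≤ B) :
    ‖w - y₀‖ ≤ δ * (1 + constC d α₁ + constC d α₂ * (constC d α₁ + 1))
      + ‖(1 / ((1 - α₂) * N * ((1 - α₁) * m))) • ∑ i ∈ G, ∑ τ ∈ H i, ξ i τ‖
      + constC d α₂ * B + constC d α₂ * constC d α₁ * V
      + constC d α₁ * (1 / ((1 - α₂) * N) * ∑ i, U i) := by
  have hm' : (1 : ℝ) ≤ m := by exact_mod_cast hm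
  have hN' : (1 : ℝ) ≤ N := by exact_mod_cast hN
  set q₁ := (1 - α₁) * m with hq₁
  set q₂ := (1 - α₂) * N with hq₂
  have hq₁0 : 0 < q₁ := by apply mul_pos <;> linarith
  have hq₂0 : 0 < q₂ := by apply mul_pos <;> linarith
  have hδ0 : 0 ≤ δ := (norm_nonneg _).trans (hδ ⟨0, hm⟩)
  have k₀ : Fin d := ⟨0, hd⟩
  have hU0 : ∀ i, 0 ≤ U i := fun i => (abs_nonneg _).trans (hU i ⟨0, hm⟩ k₀)
  have hV0 : 0 ≤ V := (abs_nonneg _).trans (hV ⟨0, hN⟩ ⟨0, hm⟩ k₀)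
  have hB0 : 0 ≤ B := (abs_nonneg _).trans (hB ⟨0, hN⟩ k₀)
  set c₁ := 4 * α₁ / (1 - α₁) with hc₁
  set c₂ := 4 * α₂ / (1 - α₂) with hc₂
  have hc₁0 : 0 ≤ c₁ := div_nonneg (by linarith) (by linarith)
  have hc₂0 : 0 ≤ c₂ := div_nonneg (by linarith) (by linarith)
  have hC₁ : Real.sqrt d * c₁ ≤ constC d α₁ := by
    rw [mul_comm]; exact mul_sqrt_le_constC d hα₁0 hα₁
  have hC₂ : Real.sqrt d * c₂ ≤ constC d α₂ := by
    rw [mul_comm]; exact mul_sqrt_le_constC d hα₂0 hα₂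
  -- Nested errors carry a single factor `√d`, already spent on `c₂`; the other constant `c₁` is
  -- bounded using only `√d ≥ 1`.
  have hcC₁ : c₁ ≤ constC d α₁ := by
    refine le_trans (le_mul_of_one_le_left hc₁0 ?_) hC₁
    rw [Real.one_le_sqrt]
    exact_mod_cast hd
  have hC₁0 := constC_nonneg d hα₁0 hα₁
  have hC₂0 := constC_nonneg d hα₂0 hα₂
  set hbar : Fin N → Vec d := fun i => (1 / q₁) • ∑ τ ∈ H i, v i τ with hhbar
  have hbark : ∀ i k, hbar i k = 1 / q₁ * ∑ τ ∈ H i, v i τ k := by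
    intro i k; simp [hhbar]
  have hsumH : ∀ (i : Fin N) (e : ℝ), 1 / q₁ * ∑ _τ ∈ H i, e = e := by
    intro i e
    rw [Finset.sum_const, nsmul_eq_mul, hH i]; field_simp
  have hsumG : ∀ e : ℝ, 1 / q₂ * ∑ _i ∈ G, e = e := by
    intro e
    rw [Finset.sum_const, nsmul_eq_mul, hG]; field_simp
  have hyk : ∀ τ k, |y τ k - y₀ k| ≤ δ := fun τ k =>
    (EuclideanSpace.abs_apply_le_norm (y τ - y₀) k).trans (hδ τ)
  have hvdev : ∀ i ∈ G, ∀ τ ∈ H i, ∀ k (e : ℝ), |ξ i τ k| ≤ e → |v i τ k - y₀ k| ≤ δ + e := by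
    intro i hi τ hτ k e he
    rw [hv i hi τ hτ, PiLp.add_apply]
    calc |y τ k + ξ i τ k - y₀ k| = |(y τ k - y₀ k) + ξ i τ k| := by ring_nf
      _ ≤ |y τ k - y₀ k| + |ξ i τ k| := abs_add_le _ _
      _ ≤ δ + e := add_le_add (hyk τ k) he
  -- The noise bound `e` is left free because it is used twice. The aggregation over agents needs
  -- the bound `V` common to all of them, but in the mean over agents the individual bounds `U i`
  -- suffice, which later yields a maximum over fewer variables.
  have htemp : ∀ i ∈ G, ∀ k (e : ℝ), (∀ τ, |ξ i τ k| ≤ e) → |u i k - hbar i k| ≤ c₁ * (δ + e) := by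
    intro i hi k e he
    rw [hbark]
    exact (hu i).abs_sub_mean_le hα₁ hm (hH i) k fun τ hτ => hvdev i hi τ hτ k e (he τ)
  have hbar0 : ∀ i ∈ G, ∀ k, |hbar i k - y₀ k| ≤ δ + B := by
    intro i hi k
    have e : hbar i k - y₀ k
        = 1 / q₁ * ∑ τ ∈ H i, (y τ k - y₀ k) + 1 / q₁ * ∑ τ ∈ H i, ξ i τ k := by
      rw [hbark, ← mul_add, ← Finset.sum_add_distrib]
      nth_rewrite 1 [← hsumH i (y₀ k)]
      rw [← mul_sub, ← Finset.sum_sub_distrib]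
      congr 1
      refine Finset.sum_congr rfl fun τ hτ => ?_
      rw [hv i hi τ hτ, PiLp.add_apply]; ring
    rw [e]
    refine (abs_add_le _ _).trans (add_le_add ?_ (hB i k))
    rw [abs_mul, abs_of_pos (by positivity)]
    calc 1 / q₁ * |∑ τ ∈ H i, (y τ k - y₀ k)| ≤ 1 / q₁ * ∑ _τ ∈ H i, δ := by
          gcongr
          exact (Finset.abs_sum_le_sum_abs _ _).trans (Finset.sum_le_sum fun τ _ => hyk τ k)
      _ = δ := hsumH i δ
  set R := c₁ * (δ + V) + (δ + B) with hR
  have hagg : ∀ k, |w k - 1 / q₂ * ∑ i ∈ G, u i k| ≤ c₂ * R := by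
    intro k
    refine hw.abs_sub_mean_le hα₂ hN hG k (w := y₀ k) fun i hi => ?_
    calc |u i k - y₀ k| = |(u i k - hbar i k) + (hbar i k - y₀ k)| := by ring_nf
      _ ≤ _ := abs_add_le _ _
      _ ≤ R := add_le_add (htemp i hi k V fun τ => hV i τ k) (hbar0 i hi k)
  set S := 1 / q₂ * ∑ i, U i with hS
  have hS0 : 0 ≤ S := mul_nonneg (by positivity) (Finset.sum_nonneg fun i _ => hU0 i)
  set E₁ : Vec d := w - (1 / q₂) • ∑ i ∈ G, hbar i with hE₁
  have hE₁k : ∀ k, |E₁ k| ≤ c₂ * R + c₁ * (δ + S) := by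
    intro k
    have e : E₁ k = (w k - 1 / q₂ * ∑ i ∈ G, u i k)
        + 1 / q₂ * ∑ i ∈ G, (u i k - hbar i k) := by
      rw [Finset.sum_sub_distrib]
      simp [hE₁]
      ring
    rw [e]
    refine (abs_add_le _ _).trans (add_le_add (hagg k) ?_)
    rw [abs_mul, abs_of_pos (by positivity)]
    calc 1 / q₂ * |∑ i ∈ G, (u i k - hbar i k)|
        ≤ 1 / q₂ * ∑ i ∈ G, c₁ * (δ + U i) := by
          gcongr
          exact (Finset.abs_sum_le_sum_abs _ _).trans
            (Finset.sum_le_sum fun i hi => htemp i hi k (U i) fun τ => hU i τ k)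
      _ = c₁ * (1 / q₂ * ∑ _i ∈ G, δ + 1 / q₂ * ∑ i ∈ G, U i) := by
          rw [← Finset.mul_sum, Finset.sum_add_distrib]; ring
      _ ≤ c₁ * (δ + S) := by
          rw [hsumG, hS]
          have := Finset.sum_le_univ_sum_of_nonneg (s := G) hU0
          gcongr
  have hR0 : 0 ≤ R := by positivity
  have hE₁n : ‖E₁‖ ≤ constC d α₂ * (constC d α₁ * (δ + V) + (δ + B))
      + constC d α₁ * (δ + S) := by
    calc ‖E₁‖ ≤ Real.sqrt d * (c₂ * R + c₁ * (δ + S)) :=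
          EuclideanSpace.norm_le_sqrt_mul (by positivity) hE₁k
      _ = (Real.sqrt d * c₂) * (c₁ * (δ + V) + (δ + B)) + (Real.sqrt d * c₁) * (δ + S) := by
          rw [hR]; ring
      _ ≤ _ := by gcongr
  set A : Vec d := (1 / (q₂ * q₁)) • ∑ i ∈ G, ∑ τ ∈ H i, ξ i τ with hA
  have hsumH' : ∀ i, (1 / q₁) • ∑ _τ ∈ H i, y₀ = y₀ := by
    intro i
    rw [Finset.sum_const, ← Nat.cast_smul_eq_nsmul ℝ, hH i, smul_smul, one_div,
      inv_mul_cancel₀ hq₁0.ne', one_smul]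
  have hsumG' : (1 / q₂) • ∑ _i ∈ G, y₀ = y₀ := by
    rw [Finset.sum_const, ← Nat.cast_smul_eq_nsmul ℝ, hG, smul_smul, one_div,
      inv_mul_cancel₀ hq₂0.ne', one_smul]
  -- The mean over the trustworthy entries splits into the drift of the exact gradients over the
  -- window and the average noise `A`.
  have hE₂ : (1 / q₂) • ∑ i ∈ G, hbar i - y₀
      = (1 / q₂) • ∑ i ∈ G, (1 / q₁) • ∑ τ ∈ H i, (y τ - y₀) + A := by
    have e1 : ∀ i ∈ G, hbar i = (1 / q₁) • ∑ τ ∈ H i, (y τ - y₀) + y₀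
        + (1 / q₁) • ∑ τ ∈ H i, ξ i τ := by
      intro i hi
      rw [Finset.sum_sub_distrib, smul_sub, hsumH' i, sub_add_cancel, ← smul_add,
        ← Finset.sum_add_distrib]
      exact congrArg (fun e => (1 / q₁) • e) (Finset.sum_congr rfl fun τ hτ => hv i hi τ hτ)
    rw [Finset.sum_congr rfl e1, Finset.sum_add_distrib, Finset.sum_add_distrib, smul_add, smul_add,
      hsumG', hA, ← Finset.smul_sum (s := G) (f := fun i => ∑ τ ∈ H i, ξ i τ), smul_smul,
      one_div_mul_one_div]
    abel
  have hdrift : ‖(1 / q₂) • ∑ i ∈ G, (1 / q₁) • ∑ τ ∈ H i, (y τ - y₀)‖ ≤ δ := by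
    rw [norm_smul, Real.norm_of_nonneg (by positivity)]
    calc 1 / q₂ * ‖∑ i ∈ G, (1 / q₁) • ∑ τ ∈ H i, (y τ - y₀)‖ ≤ 1 / q₂ * ∑ _i ∈ G, δ := by
          gcongr
          refine norm_sum_le_of_le _ fun i _ => ?_
          rw [norm_smul, Real.norm_of_nonneg (by positivity)]
          calc 1 / q₁ * ‖∑ τ ∈ H i, (y τ - y₀)‖ ≤ 1 / q₁ * ∑ _τ ∈ H i, δ := by
                gcongr
                exact norm_sum_le_of_le _ fun τ _ => hδ τ
            _ = δ := hsumH i δ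
      _ = δ := hsumG δ
  have hfin : w - y₀ = E₁ + ((1 / q₂) • ∑ i ∈ G, hbar i - y₀) := by rw [hE₁]; abel
  calc ‖w - y₀‖ ≤ ‖E₁‖ + (δ + ‖A‖) := by
        rw [hfin, hE₂]
        refine (norm_add_le _ _).trans (add_le_add le_rfl ?_)
        exact (norm_add_le _ _).trans (add_le_add hdrift le_rfl)
    _ ≤ _ := by linarith

/-- If aggregation does not fail, enough agents are trustworthy at enough times of the window. -/
lemma exists_trustworthy_selection {N m m₀ K₁ K₂ : ℕ} (hm : 1 ≤ m) {α₁ α₂ : ℝ} (hα₁ : α₁ * m = K₁)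
    (hα₂ : α₂ * N = K₂) (p : Fin (m₀ + m - 1 + 1) → Fin N → Bool) :
    ∃ (G : Finset (Fin N)) (H : Fin N → Finset (Fin m)), G.card = N - K₂ ∧
      (∀ i, (H i).card = m - K₁) ∧ (¬ AggregationFails m m₀ α₁ α₂ p → ∀ i ∈ G, ∀ τ ∈ H i,
        p ⟨m₀ + m - 1 - τ, by omega⟩ i = false) := by
  classical
  -- The index `τ` counts backwards from the end of the window, as in the temporal robust mean,
  -- whereas path indices count forwards; hence the reflection `m₀ + m - 1 - τ`.
  set T : Fin N → Finset (Fin m) := fun i =>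
    Finset.univ.filter fun τ => p ⟨m₀ + m - 1 - τ, by omega⟩ i = false with hT
  have hcount : ∀ i, (Finset.univ.filter fun r : Fin (m₀ + m - 1 + 1) =>
      m₀ ≤ (r : ℕ) ∧ p r i = true).card = (T i)ᶜ.card := by
    intro i
    refine Finset.card_bij' (fun r hr => ⟨m₀ + m - 1 - r, by
        have := (Finset.mem_filter.mp hr).2.1; omega⟩)
      (fun τ _ => ⟨m₀ + m - 1 - τ, by omega⟩) ?_ ?_ ?_ ?_
    · intro r hr
      have h := (Finset.mem_filter.mp hr).2
      have e : (⟨m₀ + m - 1 - (m₀ + m - 1 - r), by omega⟩ : Fin (m₀ + m - 1 + 1)) = r := by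
        ext; simp; omega
      simp [hT, e, h.2]
    · intro τ hτ
      simp only [hT, Finset.mem_compl, Finset.mem_filter, Finset.mem_univ, true_and,
        Bool.not_eq_false] at hτ
      simp only [Finset.mem_filter, Finset.mem_univ, true_and]
      exact ⟨by omega, hτ⟩
    · intro r hr
      ext; simp; omega
    · intro τ hτ
      ext; simp; omega
  -- The selected sets have the prescribed size on every path, even if too few times are
  -- trustworthy. The moment bounds are taken over all paths, so they need this fixed size.
  have hHex : ∀ i, ∃ h : Finset (Fin m), h.card = m - K₁ ∧ (m - K₁ ≤ (T i).card → h ⊆ T i) := by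
    intro i
    by_cases hi : m - K₁ ≤ (T i).card
    · obtain ⟨h, h1, h2⟩ := Finset.exists_subset_card_eq hi
      exact ⟨h, h2, fun _ => h1⟩
    · obtain ⟨h, -, h2⟩ := Finset.exists_subset_card_eq (s := (Finset.univ : Finset (Fin m)))
        (n := m - K₁) (by simp)
      exact ⟨h, h2, fun h3 => absurd h3 hi⟩
  choose H hHc hHs using hHex
  set T₂ : Finset (Fin N) := Finset.univ.filter fun i => m - K₁ ≤ (T i).card with hT₂
  by_cases hgood : N - K₂ ≤ T₂.card
  · obtain ⟨G, h1, h2⟩ := Finset.exists_subset_card_eq hgood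
    refine ⟨G, H, h2, hHc, fun _ i hi τ hτ => ?_⟩
    have := hHs i (Finset.mem_filter.mp (h1 hi)).2 hτ
    exact (Finset.mem_filter.mp this).2
  · obtain ⟨G, -, h2⟩ := Finset.exists_subset_card_eq (s := (Finset.univ : Finset (Fin N)))
        (n := N - K₂) (by simp)
    refine ⟨G, H, h2, hHc, fun hnf => absurd ?_ hgood⟩
    unfold AggregationFails at hnf
    rw [hα₁, hα₂, not_lt] at hnf
    simp only [Nat.cast_lt, Nat.cast_le, hcount] at hnf
    -- An agent with fewer than `m - K₁` trustworthy times is Byzantine at more than `K₁` times, and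
    -- without failure at most `K₂` agents are such.
    have hc : T₂ᶜ ⊆ Finset.univ.filter fun i : Fin N => K₁ < (T i)ᶜ.card := by
      intro i hi
      simp only [hT₂, Finset.mem_compl, Finset.mem_filter, Finset.mem_univ, true_and, not_le] at hi ⊢
      rw [Finset.card_compl, Fintype.card_fin]
      omega
    have h3 := (Finset.card_le_card hc).trans hnf
    rw [Finset.card_compl, Fintype.card_fin] at h3
    omega

/-! ### Sums over a random selection of indices -/

section

variable {Ω I P : Type*} [mΩ : MeasurableSpace Ω] {μ : Measure Ω} [Fintype P] {V : Ω → P}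

lemma measurable_apply_fiber (hV : ∀ p, MeasurableSet {ω | V ω = p}) {g : P → Ω → ℝ}
    (hg : ∀ p, Measurable (g p)) : Measurable fun ω => g (V ω) ω := by
  classical
  have e : (fun ω => g (V ω) ω) = fun ω => ∑ p, Set.indicator {ω | V ω = p} (g p) ω := by
    funext ω
    simp [Set.indicator_apply]
  rw [e]
  exact Finset.measurable_sum _ fun p _ => (hg p).indicator (hV p)

lemma integrable_apply_fiber (hV : ∀ p, MeasurableSet {ω | V ω = p}) {g : P → Ω → ℝ}
    (hg : ∀ p, Integrable (g p) μ) : Integrable (fun ω => g (V ω) ω) μ := by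
  classical
  have e : (fun ω => g (V ω) ω) = fun ω => ∑ p, Set.indicator {ω | V ω = p} (g p) ω := by
    funext ω
    simp [Set.indicator_apply]
  rw [e]
  exact integrable_finsetSum _ fun p _ => (hg p).indicator (hV p)

/-- Second moment of the sum of a selection of random variables that are uncorrelated given the
selection. -/
lemma integral_selected_sum_sq_le [IsProbabilityMeasure μ] (hV : ∀ p, MeasurableSet {ω | V ω = p})
    {η : I → Ω → ℝ} (hη : ∀ a, MemLp (η a) 2 μ) {v : ℝ} {Q : ℕ}
    (horth : ∀ p a c, a ≠ c → ∫ ω in {ω | V ω = p}, η a ω * η c ω ∂μ = 0)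
    (hsq : ∀ p a, ∫ ω in {ω | V ω = p}, (η a ω ^ 2 - v) ∂μ ≤ 0)
    {sel : P → Finset I} (hsel : ∀ p, (sel p).card = Q) :
    Integrable (fun ω => (∑ a ∈ sel (V ω), η a ω) ^ 2) μ ∧
      ∫ ω, (∑ a ∈ sel (V ω), η a ω) ^ 2 ∂μ ≤ Q * v := by
  classical
  have hi : Integrable (fun ω => (∑ a ∈ sel (V ω), η a ω) ^ 2) μ :=
    integrable_apply_fiber hV (g := fun p ω => (∑ a ∈ sel p, η a ω) ^ 2) fun p =>
      (memLp_finsetSum (sel p) fun a _ => hη a).integrable_sq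
  refine ⟨hi, ?_⟩
  rw [integral_eq_sum_fiber hV hi]
  -- On the event `V = p` the selection is deterministic, so the square can be expanded; only its
  -- diagonal terms survive.
  have hp : ∀ p, ∫ ω in {ω | V ω = p}, (∑ a ∈ sel (V ω), η a ω) ^ 2 ∂μ
      ≤ Q * v * μ.real {ω | V ω = p} := by
    intro p
    have e1 : ∫ ω in {ω | V ω = p}, (∑ a ∈ sel (V ω), η a ω) ^ 2 ∂μ
        = ∫ ω in {ω | V ω = p}, ∑ a ∈ sel p, ∑ c ∈ sel p, η a ω * η c ω ∂μ := by
      refine setIntegral_congr_fun (hV p) fun ω hω => ?_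
      rw [show V ω = p from hω, sq, Finset.sum_mul_sum]
    have hac : ∀ a c, IntegrableOn (fun ω => η a ω * η c ω) {ω | V ω = p} μ := fun a c =>
      ((hη a).integrable_mul (hη c)).integrableOn
    have e2 : ∀ a, ∫ ω in {ω | V ω = p}, η a ω * η a ω ∂μ ≤ v * μ.real {ω | V ω = p} := by
      intro a
      have h1 := hsq p a
      rw [integral_sub (hη a).integrable_sq.integrableOn (integrable_const _)] at h1
      simp only [integral_const, smul_eq_mul, measureReal_restrict_apply_univ] at h1
      simp_rw [← sq]
      linarith
    rw [e1, integral_finsetSum _ fun a _ => integrable_finsetSum _ fun c _ => hac a c]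
    calc ∑ a ∈ sel p, ∫ ω in {ω | V ω = p}, ∑ c ∈ sel p, η a ω * η c ω ∂μ
        ≤ ∑ _a ∈ sel p, v * μ.real {ω | V ω = p} := by
          refine Finset.sum_le_sum fun a ha => ?_
          rw [integral_finsetSum _ fun c _ => hac a c, Finset.sum_eq_single a
            (fun c _ hca => horth p a c hca.symm) (fun h => absurd ha h)]
          exact e2 a
      _ = Q * v * μ.real {ω | V ω = p} := by
          rw [Finset.sum_const, nsmul_eq_mul, hsel]; ring
  refine (Finset.sum_le_sum fun p _ => hp p).trans_eq ?_
  rw [← Finset.mul_sum]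
  have h1 := integral_eq_sum_fiber hV (integrable_const (1 : ℝ) (μ := μ))
  simp only [integral_const, smul_eq_mul, mul_one, measureReal_restrict_apply_univ,
    probReal_univ] at h1
  rw [← h1, mul_one]

lemma integral_le_sqrt_of_sq [IsProbabilityMeasure μ] {Y : Ω → ℝ} (hY : AEStronglyMeasurable Y μ)
    {v : ℝ} (hi : Integrable (fun ω => Y ω ^ 2) μ) (hv : ∫ ω, Y ω ^ 2 ∂μ ≤ v) :
    Integrable Y μ ∧ ∫ ω, Y ω ∂μ ≤ Real.sqrt v := by
  have hL : MemLp Y 2 μ := (memLp_two_iff_integrable_sq hY).mpr hi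
  refine ⟨hL.integrable one_le_two, Real.le_sqrt_of_sq_le ?_⟩
  have h1 := variance_nonneg Y μ
  rw [variance_eq_sub hL] at h1
  change 0 ≤ ∫ ω, Y ω ^ 2 ∂μ - (∫ ω, Y ω ∂μ) ^ 2 at h1
  linarith

/-- Each coordinate of the sum has second moment at most `Q s²`. Summing over `d` coordinates and
dividing by `Q²` gives `s² d / Q`, whose root bounds the mean norm. -/
lemma integral_norm_selected_mean_le [IsProbabilityMeasure μ] {d : ℕ}
    (hV : ∀ p, MeasurableSet {ω | V ω = p})
    {ξ : I → Ω → Vec d} (hξm : ∀ a, Measurable (ξ a)) (hξ : ∀ a k, MemLp (fun ω => ξ a ω k) 2 μ)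
    {s : ℝ} (hs : 0 ≤ s) {Q : ℕ} (hQ : 1 ≤ Q)
    (horth : ∀ k p a c, a ≠ c → ∫ ω in {ω | V ω = p}, ξ a ω k * ξ c ω k ∂μ = 0)
    (hsq : ∀ k p a, ∫ ω in {ω | V ω = p}, (ξ a ω k ^ 2 - s ^ 2) ∂μ ≤ 0)
    {sel : P → Finset I} (hsel : ∀ p, (sel p).card = Q) :
    Integrable (fun ω => ‖(1 / (Q : ℝ)) • ∑ a ∈ sel (V ω), ξ a ω‖) μ ∧
      ∫ ω, ‖(1 / (Q : ℝ)) • ∑ a ∈ sel (V ω), ξ a ω‖ ∂μ ≤ s * Real.sqrt d / Real.sqrt Q := by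
  have hQ' : (0 : ℝ) < Q := by exact_mod_cast hQ
  have hk := fun k => integral_selected_sum_sq_le hV (hξ · k) (horth k) (hsq k) hsel
  have e : ∀ ω, ‖(1 / (Q : ℝ)) • ∑ a ∈ sel (V ω), ξ a ω‖ ^ 2
      = ∑ k, (1 / (Q : ℝ)) ^ 2 * (∑ a ∈ sel (V ω), ξ a ω k) ^ 2 := by
    intro ω
    rw [EuclideanSpace.norm_sq_eq]
    refine Finset.sum_congr rfl fun k _ => ?_
    rw [Real.norm_eq_abs, sq_abs]
    simp [mul_pow]
  have hm : Measurable fun ω => ‖(1 / (Q : ℝ)) • ∑ a ∈ sel (V ω), ξ a ω‖ :=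
    measurable_apply_fiber hV (g := fun p ω => ‖(1 / (Q : ℝ)) • ∑ a ∈ sel p, ξ a ω‖) fun p => by
      fun_prop
  have hi : Integrable (fun ω => ‖(1 / (Q : ℝ)) • ∑ a ∈ sel (V ω), ξ a ω‖ ^ 2) μ := by
    simp_rw [e]
    exact integrable_finsetSum _ fun k _ => (hk k).1.const_mul _
  have key := integral_le_sqrt_of_sq hm.aestronglyMeasurable hi (v := s ^ 2 * d / Q) (by
    simp_rw [e]
    rw [integral_finsetSum _ fun k _ => (hk k).1.const_mul _]
    calc ∑ k, ∫ ω, (1 / (Q : ℝ)) ^ 2 * (∑ a ∈ sel (V ω), ξ a ω k) ^ 2 ∂μ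
        ≤ ∑ _k : Fin d, (1 / (Q : ℝ)) ^ 2 * (Q * s ^ 2) := by
          refine Finset.sum_le_sum fun k _ => ?_
          rw [integral_const_mul]
          gcongr
          exact (hk k).2
      _ = s ^ 2 * d / Q := by
          rw [Finset.sum_const, Finset.card_univ, Fintype.card_fin, nsmul_eq_mul]
          field_simp)
  refine ⟨key.1, key.2.trans_eq ?_⟩
  rw [Real.sqrt_div (by positivity), Real.sqrt_mul (by positivity), Real.sqrt_sq hs]

/-- Exponential moments of the absolute value of a sub-gamma variable. -/
lemma IsSubGamma.integral_exp_abs_le {X : Ω → ℝ} {s c : ℝ} (h : IsSubGamma μ X s c)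
    (hX : Measurable X) {l : ℝ} (hl : 0 < l) (hcl : c * l < 1) :
    Integrable (fun ω => Real.exp (l * |X ω|)) μ ∧
      ∫ ω, Real.exp (l * |X ω|) ∂μ ≤ 2 * Real.exp (l ^ 2 * s ^ 2 / (2 * (1 - c * l))) := by
  have hl' : c * |l| < 1 := by rwa [abs_of_pos hl]
  have h1 := h.integrable_exp hl'
  have h2 := h.neg.integrable_exp hl'
  have e1 := h.integral_exp_le hl'
  have e2 := h.neg.integral_exp_le hl'
  rw [abs_of_pos hl] at e1 e2
  have hle : ∀ ω, Real.exp (l * |X ω|) ≤ Real.exp (l * X ω) + Real.exp (l * -X ω) := by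
    intro ω
    rcases abs_choice (X ω) with h | h <;> rw [h] <;>
      linarith [Real.exp_pos (l * X ω), Real.exp_pos (l * -X ω)]
  have hi : Integrable (fun ω => Real.exp (l * |X ω|)) μ := by
    refine (h1.add h2).mono' (by fun_prop) (ae_of_all _ fun ω => ?_)
    rw [Real.norm_of_nonneg (Real.exp_pos _).le]
    exact hle ω
  refine ⟨hi, ?_⟩
  calc ∫ ω, Real.exp (l * |X ω|) ∂μ
      ≤ ∫ ω, (Real.exp (l * X ω) + Real.exp (l * -X ω)) ∂μ := integral_mono hi (h1.add h2) hle
    _ = ∫ ω, Real.exp (l * X ω) ∂μ + ∫ ω, Real.exp (l * -X ω) ∂μ := integral_add h1 h2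
    _ ≤ _ := by linarith

lemma exp_mul_abs_mean_le {J : Type*} {S : Finset J} {q l : ℝ} (hq : 0 < q) (hS : (S.card : ℝ) = q)
    (hl : 0 ≤ l) (y : J → ℝ) :
    Real.exp (l * |1 / q * ∑ j ∈ S, y j|) ≤ 1 / q * ∑ j ∈ S, Real.exp (l * |y j|) := by
  have h1 := convexOn_exp.map_sum_le (t := S) (w := fun _ => 1 / q) (p := fun j => l * |y j|)
    (fun _ _ => by positivity) (by rw [Finset.sum_const, nsmul_eq_mul, hS]; field_simp)
    (fun _ _ => Set.mem_univ _)
  simp only [smul_eq_mul, ← Finset.mul_sum] at h1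
  refine le_trans (Real.exp_le_exp.mpr ?_) h1
  rw [abs_mul, abs_of_pos (by positivity)]
  calc l * (1 / q * |∑ j ∈ S, y j|) ≤ l * (1 / q * ∑ j ∈ S, |y j|) := by
        gcongr
        exact Finset.abs_sum_le_sum_abs _ _
    _ = _ := by ring

/-- Exponential moments of the mean of a selection of more than half of some sub-gamma
variables. -/
lemma integral_exp_abs_selected_mean_le {J : Type*} [Fintype J]
    (hV : ∀ p, MeasurableSet {ω | V ω = p})
    {X : J → Ω → ℝ} (hXm : ∀ j, Measurable (X j)) {s c : ℝ} (hX : ∀ j, IsSubGamma μ (X j) s c)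
    {q : ℝ} (hq : 0 < q) (hJ : (Fintype.card J : ℝ) ≤ 2 * q)
    {sel : P → Finset J} (hsel : ∀ p, ((sel p).card : ℝ) = q) {l : ℝ} (hl : 0 < l)
    (hcl : c * l < 1) :
    Integrable (fun ω => Real.exp (l * |1 / q * ∑ j ∈ sel (V ω), X j ω|)) μ ∧
      ∫ ω, Real.exp (l * |1 / q * ∑ j ∈ sel (V ω), X j ω|) ∂μ
        ≤ 4 * Real.exp (l ^ 2 * s ^ 2 / (2 * (1 - c * l))) := by
  have hj := fun j => (hX j).integral_exp_abs_le (hXm j) hl hcl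
  have hdom : Integrable (fun ω => 1 / q * ∑ j, Real.exp (l * |X j ω|)) μ :=
    (integrable_finsetSum _ fun j _ => (hj j).1).const_mul _
  -- By Jensen's inequality the exponential of the mean is at most the mean of exponentials.
  -- Extending the sum to all of `J` removes the dependence on the random selection; it costs the
  -- factor `Fintype.card J / q ≤ 2`, on top of the factor `2` from the absolute value.
  have hle : ∀ ω, Real.exp (l * |1 / q * ∑ j ∈ sel (V ω), X j ω|)
      ≤ 1 / q * ∑ j, Real.exp (l * |X j ω|) := by
    intro ω
    refine (exp_mul_abs_mean_le hq (hsel _) hl.le _).trans ?_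
    exact mul_le_mul_of_nonneg_left (Finset.sum_le_univ_sum_of_nonneg
      fun j => (Real.exp_pos _).le) (by positivity)
  have hm : Measurable fun ω => Real.exp (l * |1 / q * ∑ j ∈ sel (V ω), X j ω|) :=
    measurable_apply_fiber hV (g := fun p ω => Real.exp (l * |1 / q * ∑ j ∈ sel p, X j ω|))
      fun p => by fun_prop
  have hi : Integrable (fun ω => Real.exp (l * |1 / q * ∑ j ∈ sel (V ω), X j ω|)) μ := by
    refine hdom.mono' hm.aestronglyMeasurable (ae_of_all _ fun ω => ?_)
    rw [Real.norm_of_nonneg (Real.exp_pos _).le]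
    exact hle ω
  refine ⟨hi, (integral_mono hi hdom hle).trans ?_⟩
  rw [integral_const_mul, integral_finsetSum _ fun j _ => (hj j).1]
  set e := Real.exp (l ^ 2 * s ^ 2 / (2 * (1 - c * l)))
  calc 1 / q * ∑ j, ∫ ω, Real.exp (l * |X j ω|) ∂μ ≤ 1 / q * ∑ _j : J, 2 * e := by
        gcongr with j
        exact (hj j).2
    _ = Fintype.card J / q * (2 * e) := by
        rw [Finset.sum_const, Finset.card_univ, nsmul_eq_mul]; ring
    _ ≤ 2 * (2 * e) := by
        gcongr
        rwa [div_le_iff₀ hq]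
    _ = 4 * e := by ring

end

/-! ### Noises given the states -/

section

variable {Ω Z β : Type*} [mΩ : MeasurableSpace Ω] [MeasurableSpace Z] [MeasurableSpace β]
  {N b : ℕ} {μ : Measure Ω} [IsProbabilityMeasure μ] {ℱ : Filtration ℕ mΩ} {D : Measure Z}
  [IsProbabilityMeasure D] {pb pt : ℝ} {W : ℕ → Ω → Fin N → Bool}
  {ζ : ℕ → Ω → Fin N → Fin b → Z} {φ : β → (Fin b → Z) → ℝ} {X : ℕ → Ω → β} {s c : ℝ}

namespace IsSASetting

lemma setIntegral_statePath_sq_sub_nonpos (h : IsSASetting μ ℱ D pb pt W ζ) (hpb : 0 ≤ pb)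
    (hpb1 : pb ≤ 1) (hpt : 0 ≤ pt) (hpt1 : pt ≤ 1)
    (hφ : Measurable fun p : β × (Fin b → Z) => φ p.1 p.2)
    (hsub : ∀ x, IsSubGamma (Measure.pi fun _ : Fin b => D) (φ x) s c)
    {r n u : ℕ} (hr : 1 ≤ r) (hru : r ≤ u) (hun : u ≤ r + n)
    (hX : Measurable[ℱ (u - 1)] (X u)) (i : Fin N) (p : Fin (n + 1) → Fin N → Bool) :
    ∫ ω in {ω | statePath W r n ω = p}, (φ (X u ω) (ζ u ω i) ^ 2 - s ^ 2) ∂μ ≤ 0 := by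
  have hu : 1 ≤ u := hr.trans hru
  exact h.setIntegral_statePath_nonpos hpb hpb1 hpt hpt1 hr hru hun
    (((h.measurable_sample_noise hφ hu hX i).pow_const 2).sub_const _).stronglyMeasurable
    ((h.memLp_sample hφ hsub hu hX i).integrable_sq.sub (integrable_const _))
    (fun A hA => h.setIntegral_sample_sq_sub_nonpos hφ hsub hu hX i hA) p

/-- Different noises are uncorrelated given the states in a time window. -/
lemma setIntegral_statePath_mul_eq_zero (h : IsSASetting μ ℱ D pb pt W ζ) (hpb : 0 ≤ pb)
    (hpb1 : pb ≤ 1) (hpt : 0 ≤ pt) (hpt1 : pt ≤ 1)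
    (hφ : Measurable fun p : β × (Fin b → Z) => φ p.1 p.2)
    (hsub : ∀ x, IsSubGamma (Measure.pi fun _ : Fin b => D) (φ x) s c)
    {r n u v : ℕ} (hr : 1 ≤ r) (hru : r ≤ u) (hun : u ≤ r + n) (hrv : r ≤ v) (hvn : v ≤ r + n)
    (hX : ∀ t, r ≤ t → t ≤ r + n → Measurable[ℱ (t - 1)] (X t)) {i j : Fin N}
    (hij : u = v → i ≠ j) (p : Fin (n + 1) → Fin N → Bool) :
    ∫ ω in {ω | statePath W r n ω = p}, φ (X u ω) (ζ u ω i) * φ (X v ω) (ζ v ω j) ∂μ = 0 := by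
  -- Conditioning is done at the later time `v`. If `u < v`, the earlier noise is known and the
  -- later one centred; if `u = v`, different agents have independent samples.
  wlog huv : u ≤ v generalizing u v i j
  · rw [← this hrv hvn hru hun (fun h1 h2 => hij h1.symm h2.symm) (by omega)]
    simp_rw [mul_comm]
  have hu : 1 ≤ u := hr.trans hru
  have hv : 1 ≤ v := hr.trans hrv
  have hmu := h.measurable_sample_noise hφ hu (hX u hru hun) i
  have hmv := h.measurable_sample_noise hφ hv (hX v hrv hvn) j
  have hLu := h.memLp_sample hφ hsub hu (hX u hru hun) i
  have hLv := h.memLp_sample hφ hsub hv (hX v hrv hvn) j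
  -- The one-sided lemma on path events gives an equality when applied with both signs of `ε`.
  have key : ∀ ε : ℝ, ∫ ω in {ω | statePath W r n ω = p},
      ε * (φ (X u ω) (ζ u ω i) * φ (X v ω) (ζ v ω j)) ∂μ ≤ 0 := by
    intro ε
    refine h.setIntegral_statePath_nonpos hpb hpb1 hpt hpt1 hr hrv hvn
      (((hmu.mono (ℱ.mono huv) le_rfl).mul hmv).const_mul ε).stronglyMeasurable
      ((hLu.integrable_mul hLv).const_mul ε) (fun A hA => ?_) p
    change ∫ ω in A, ε * (φ (X u ω) (ζ u ω i) * φ (X v ω) (ζ v ω j)) ∂μ ≤ 0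
    rcases huv.eq_or_lt with rfl | hlt
    · exact h.setIntegral_sample_mul_nonpos hφ hsub hv (hX u hrv hvn) (hij rfl) ε hA
    · have := h.setIntegral_past_mul_sample_nonpos hφ hsub hv (hX v hrv hvn) j
        (Y := fun ω => ε * φ (X u ω) (ζ u ω i))
        ((hmu.mono (ℱ.mono (by omega)) le_rfl).const_mul ε) (hLu.const_mul ε) hA
      simpa only [mul_assoc] using this
  have h1 := key 1
  have h2 := key (-1)
  rw [integral_const_mul] at h1 h2
  linarith

end IsSASetting

end

/-! ### Deviation bounds -/

lemma maxDev_eq (σ a : ℝ) (b : ℕ) (n : ℝ) :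
    maxDev σ a b n = σ / Real.sqrt b * Real.sqrt (2 * Real.log n) + a / b * Real.log n := by
  unfold maxDev; ring

lemma maxDev_nonneg {σ a : ℝ} (hσ : 0 ≤ σ) (ha : 0 ≤ a) (b : ℕ) {n : ℝ} (hn : 1 ≤ n) :
    0 ≤ maxDev σ a b n := by
  have := Real.log_nonneg hn
  unfold maxDev
  positivity

/-- Squaring the argument doubles its logarithm, and `√2 ≤ 2`. The square absorbs the numerical
factors in the maximal inequalities. -/
lemma maxDev_sq_le {σ a : ℝ} (hσ : 0 ≤ σ) (b : ℕ) {n : ℝ} (hn : 1 ≤ n) :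
    maxDev σ a b (n ^ 2) ≤ 2 * maxDev σ a b n := by
  have hlog := Real.log_nonneg hn
  rw [maxDev_eq, maxDev_eq, Real.log_pow]
  have h1 : Real.sqrt (2 * ((2 : ℕ) * Real.log n)) ≤ 2 * Real.sqrt (2 * Real.log n) := by
    rw [Real.sqrt_le_left (by positivity), mul_pow, Real.sq_sqrt (by positivity)]
    push_cast
    linarith
  have h2 : 0 ≤ σ / Real.sqrt b := by positivity
  have := mul_le_mul_of_nonneg_left h1 h2
  push_cast at this ⊢
  linarith

/-! ### Runs of the algorithm -/

namespace IsRangeRun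

variable {Ω Z : Type*} [mΩ : MeasurableSpace Ω] {d N b : ℕ}
    {ℱ : Filtration ℕ mΩ} {f : Vec d → Z → ℝ}
    {W : ℕ → Ω → Fin N → Bool} {ζ : ℕ → Ω → Fin N → Fin b → Z}
    {m : ℕ} {α₁ α₂ γ : ℝ} {x₁ : Vec d} {n : ℕ}
    {x : ℕ → Ω → Vec d} {g g' : ℕ → Fin N → Ω → Vec d} {g'' : ℕ → Ω → Vec d}

/-- The iterate `x t` is known before the states and samples of time `t`, so the samples are fresh
relative to it. -/
lemma measurable_iterate (h : IsRangeRun ℱ f W ζ m α₁ α₂ γ x₁ n x g g' g'') {t : ℕ} (ht : 1 ≤ t)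
    (htn : t ≤ n + 1) : Measurable[ℱ (t - 1)] (x t) := by
  induction t, ht using Nat.le_induction with
  | base =>
    have : x 1 = fun _ => x₁ := funext h.init
    rw [this]
    exact measurable_const
  | succ t ht ih =>
    have e : x (t + 1) = fun ω => x t ω - γ • (‖g'' t ω‖⁻¹ • g'' t ω) :=
      funext (h.update t ht (by omega))
    have h1 : Measurable[ℱ t] (x t) := (ih (by omega)).mono (ℱ.mono (by omega)) le_rfl
    have h2 := h.measurable_aggregate t ht (by omega)
    rw [e, Nat.add_sub_cancel]
    have h3 : Measurable fun p : Vec d × Vec d => p.1 - γ • (‖p.2‖⁻¹ • p.2) := by fun_prop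
    exact h3.comp (h1.prodMk h2)

lemma norm_iterate_sub_le (h : IsRangeRun ℱ f W ζ m α₁ α₂ γ x₁ n x g g' g'') (hγ : 0 ≤ γ)
    {t : ℕ} (ht : 1 ≤ t) (k : ℕ) (htn : t + k ≤ n + 1) (ω : Ω) :
    ‖x (t + k) ω - x t ω‖ ≤ γ * k := by
  induction k with
  | zero => simp
  | succ k ih =>
    rw [← add_assoc, h.update (t + k) (by omega) (by omega)]
    calc ‖x (t + k) ω - γ • (‖g'' (t + k) ω‖⁻¹ • g'' (t + k) ω) - x t ω‖
        = ‖(x (t + k) ω - x t ω) - γ • (‖g'' (t + k) ω‖⁻¹ • g'' (t + k) ω)‖ := by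
          congr 1; abel
      _ ≤ γ * k + γ * 1 := by
          refine (norm_sub_le _ _).trans (add_le_add (ih (by omega)) ?_)
          rw [norm_smul, Real.norm_of_nonneg hγ]
          gcongr
          exact norm_normalized_le_one _
      _ = γ * (k + 1 : ℕ) := by push_cast; ring

variable [MeasurableSpace Z] {D : Measure Z} {L : ℝ}

lemma norm_gradient_sub_le (h : IsRangeRun ℱ f W ζ m α₁ α₂ γ x₁ n x g g' g'') (hγ : 0 ≤ γ)
    (hL : 0 ≤ L) (hF : IsSmooth L (risk D f)) {t : ℕ} (ht : 1 ≤ t) (k : ℕ)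
    (htn : t + k ≤ n + 1) (ω : Ω) :
    ‖gradient (risk D f) (x (t + k) ω) - gradient (risk D f) (x t ω)‖ ≤ L * (γ * k) :=
  (hF.2 _ _).trans (mul_le_mul_of_nonneg_left (h.norm_iterate_sub_le hγ ht k htn ω) hL)

/-- Normalized steps keep the iterate within a deterministic distance of `x₁`, so the gradient norm
is bounded whatever the Byzantine agents send. -/
lemma integrable_norm_gradient (h : IsRangeRun ℱ f W ζ m α₁ α₂ γ x₁ n x g g' g'') (hγ : 0 ≤ γ)
    (hL : 0 ≤ L) (hF : IsSmooth L (risk D f)) {μ : Measure Ω} [IsProbabilityMeasure μ] {t : ℕ}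
    (ht : 1 ≤ t) (htn : t ≤ n + 1) :
    Integrable (fun ω => ‖gradient (risk D f) (x t ω)‖) μ := by
  have hm : Measurable (x t) := (h.measurable_iterate ht htn).mono (ℱ.le _) le_rfl
  refine (integrable_const (‖gradient (risk D f) x₁‖ + L * (γ * (t - 1 : ℕ)))).mono'
    (hF.continuous_gradient.measurable.comp hm).norm.aestronglyMeasurable
    (ae_of_all _ fun ω => ?_)
  rw [norm_norm]
  have h1 := h.norm_gradient_sub_le hγ hL hF le_rfl (t - 1) (by omega) ω
  rw [h.init, Nat.add_sub_cancel' ht] at h1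
  have h2 := norm_le_norm_add_norm_sub' (gradient (risk D f) (x t ω)) (gradient (risk D f) x₁)
  linarith

end IsRangeRun

/-! ### Expected aggregation error -/

lemma integral_affine_combination {Ω : Type*} [MeasurableSpace Ω] {μ : Measure Ω}
    [IsProbabilityMeasure μ] {A B V U : Ω → ℝ} (hA : Integrable A μ) (hB : Integrable B μ)
    (hV : Integrable V μ) (hU : Integrable U μ) (E p q r : ℝ) :
    Integrable (fun ω => E + A ω + p * B ω + q * V ω + r * U ω) μ ∧
    ∫ ω, (E + A ω + p * B ω + q * V ω + r * U ω) ∂μ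
      = E + ∫ ω, A ω ∂μ + p * ∫ ω, B ω ∂μ + q * ∫ ω, V ω ∂μ + r * ∫ ω, U ω ∂μ := by
  have i1 : Integrable (fun ω => E + A ω) μ := (integrable_const _).add hA
  have i2 : Integrable (fun ω => E + A ω + p * B ω) μ := i1.add (hB.const_mul _)
  have i3 : Integrable (fun ω => E + A ω + p * B ω + q * V ω) μ := i2.add (hV.const_mul _)
  refine ⟨i3.add (hU.const_mul _), ?_⟩
  rw [integral_add i3 (hU.const_mul _), integral_add i2 (hV.const_mul _),
    integral_add i1 (hB.const_mul _), integral_add (integrable_const _) hA,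
    integral_const_mul, integral_const_mul, integral_const_mul]
  simp

/-- The expectation of the bound on the aggregation error: `V` is the path of the states, which
determines the selected agents `G` and times `H`, and `ξ` is the noise. -/
lemma integral_noise_bound_le {Ω P : Type*} [MeasurableSpace Ω] {μ : Measure Ω}
    [IsProbabilityMeasure μ] [Fintype P] {V : Ω → P} (hV : ∀ p, MeasurableSet {ω | V ω = p})
    {d N m b q₁ q₂ : ℕ} (hd : 1 ≤ d) (hm : 1 ≤ m) (hN : 1 ≤ N) (hb : 1 ≤ b)
    (hq₁ : m ≤ 2 * q₁) (hq₂ : N + 1 ≤ 2 * q₂) {σ a : ℝ} (hσ : 0 ≤ σ) (ha : 0 ≤ a)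
    {ξ : Fin N → Fin m → Ω → Vec d} (hξm : ∀ i τ, Measurable (ξ i τ))
    (hξsub : ∀ i τ k, IsSubGamma μ (fun ω => ξ i τ ω k) (σ / Real.sqrt b) (a / b))
    (horth : ∀ k p i τ j τ', (τ = τ' → i ≠ j) →
      ∫ ω in {ω | V ω = p}, ξ i τ ω k * ξ j τ' ω k ∂μ = 0)
    (hsq : ∀ k p i τ,
      ∫ ω in {ω | V ω = p}, (ξ i τ ω k ^ 2 - (σ / Real.sqrt b) ^ 2) ∂μ ≤ 0)
    {G : P → Finset (Fin N)} {H : P → Fin N → Finset (Fin m)} (hG : ∀ p, (G p).card = q₂)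
    (hH : ∀ p i, (H p i).card = q₁) {E C₁ C₂ : ℝ} (hC₁ : 0 ≤ C₁) (hC₂ : 0 ≤ C₂) :
    Integrable (fun ω => E
      + ‖(1 / ((q₂ : ℝ) * q₁)) • ∑ i ∈ G (V ω), ∑ τ ∈ H (V ω) i, ξ i τ ω‖
      + C₂ * ‖fun e : Fin N × Fin d => 1 / (q₁ : ℝ) * ∑ τ ∈ H (V ω) e.1, ξ e.1 τ ω e.2‖
      + C₂ * C₁ * ‖fun e : Fin N × Fin m × Fin d => ξ e.1 e.2.1 ω e.2.2‖
      + C₁ * (1 / (q₂ : ℝ) * ∑ i, ‖fun e : Fin m × Fin d => ξ i e.1 ω e.2‖)) μ ∧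
    ∫ ω, (E
      + ‖(1 / ((q₂ : ℝ) * q₁)) • ∑ i ∈ G (V ω), ∑ τ ∈ H (V ω) i, ξ i τ ω‖
      + C₂ * ‖fun e : Fin N × Fin d => 1 / (q₁ : ℝ) * ∑ τ ∈ H (V ω) e.1, ξ e.1 τ ω e.2‖
      + C₂ * C₁ * ‖fun e : Fin N × Fin m × Fin d => ξ e.1 e.2.1 ω e.2.2‖
      + C₁ * (1 / (q₂ : ℝ) * ∑ i, ‖fun e : Fin m × Fin d => ξ i e.1 ω e.2‖)) ∂μ
    ≤ E + (σ * Real.sqrt d / Real.sqrt (q₁ * q₂ * b)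
        + 2 * C₂ * maxDev σ a b (2 * q₂ * d)
        + 2 * C₁ * maxDev σ a b (4 * q₁ * d)
        + 4 * C₁ * C₂ * maxDev σ a b (4 * q₂ * q₁ * d)) := by
  have hm' : (1 : ℝ) ≤ m := by exact_mod_cast hm
  have hN' : (1 : ℝ) ≤ N := by exact_mod_cast hN
  have hb' : (0 : ℝ) < b := by exact_mod_cast hb
  have hd' : (1 : ℝ) ≤ d := by exact_mod_cast hd
  have hq₁m' : (m : ℝ) ≤ 2 * q₁ := by exact_mod_cast hq₁
  have hq₂N' : (N : ℝ) + 1 ≤ 2 * q₂ := by exact_mod_cast hq₂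
  have hq₁1 : 1 ≤ q₁ := by omega
  have hq₂1 : 1 ≤ q₂ := by omega
  have hq₁1' : (1 : ℝ) ≤ q₁ := by exact_mod_cast hq₁1
  have hq₂1' : (1 : ℝ) ≤ q₂ := by exact_mod_cast hq₂1
  have hs0 : 0 ≤ σ / Real.sqrt b := by positivity
  have hc0 : 0 ≤ a / b := by positivity
  have hn₁ : 1 < 4 * (q₁ : ℝ) * d := by nlinarith
  have hn₂ : 2 ≤ 2 * (q₂ : ℝ) * d := by nlinarith
  have hn₃ : 1 < 4 * (q₂ : ℝ) * q₁ * d := by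
    have h1 : (1 : ℝ) ≤ q₂ * q₁ := by nlinarith
    nlinarith
  have hξkm : ∀ i τ k, Measurable fun ω => ξ i τ ω k := fun i τ k => by
    have := hξm i τ
    fun_prop
  -- the average of the noises of the selected agents and times
  have hA := integral_norm_selected_mean_le (I := Σ _ : Fin N, Fin m) hV
    (ξ := fun e => ξ e.1 e.2) (fun e => hξm e.1 e.2)
    (fun e k => (hξsub e.1 e.2 k).memLp_two (hξkm e.1 e.2 k).aestronglyMeasurable) hs0
    (Q := q₂ * q₁) (Nat.mul_pos hq₂1 hq₁1)
    (fun k p e e' hne => horth k p e.1 e.2 e'.1 e'.2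
      fun h1 h2 => hne (Sigma.ext h2 (heq_of_eq h1)))
    (fun k p e => hsq k p e.1 e.2)
    (sel := fun p => (G p).sigma fun i => H p i) (fun p => by
      rw [Finset.card_sigma, Finset.sum_congr rfl fun i _ => hH p i, Finset.sum_const, smul_eq_mul,
        hG])
  simp_rw [Finset.sum_sigma, Nat.cast_mul] at hA
  -- the maximal noise of one agent
  have hne₁ : Nonempty (Fin m × Fin d) := ⟨(⟨0, hm⟩, ⟨0, hd⟩)⟩
  have hU := fun i => integral_pi_norm_le (μ := μ) (ι := Fin m × Fin d)
    (X := fun ω e => ξ i e.1 ω e.2) (K := 2) (n := 4 * q₁ * d) hs0 hc0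
    (fun e => hξkm i e.1 e.2)
    (fun e l hl hcl => (hξsub i e.1 e.2).integral_exp_abs_le (hξkm i e.1 e.2) hl hcl)
    hn₁ (by
      rw [Fintype.card_prod, Fintype.card_fin, Fintype.card_fin]
      push_cast
      calc 2 * ((m : ℝ) * d) = 2 * m * d := by ring
        _ ≤ 2 * (2 * q₁) * d := by gcongr
        _ = _ := by ring)
  -- the maximal noise of all agents
  have hne₂ : Nonempty (Fin N × Fin m × Fin d) := ⟨(⟨0, hN⟩, ⟨0, hm⟩, ⟨0, hd⟩)⟩
  have hVm := integral_pi_norm_le (μ := μ) (ι := Fin N × Fin m × Fin d)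
    (X := fun ω e => ξ e.1 e.2.1 ω e.2.2) (K := 2) (n := (4 * q₂ * q₁ * d) ^ 2) hs0 hc0
    (fun e => hξkm e.1 e.2.1 e.2.2)
    (fun e l hl hcl => (hξsub e.1 e.2.1 e.2.2).integral_exp_abs_le (hξkm e.1 e.2.1 e.2.2) hl hcl)
    (by nlinarith) (by
      rw [Fintype.card_prod, Fintype.card_prod, Fintype.card_fin, Fintype.card_fin,
        Fintype.card_fin]
      push_cast
      have h1 : (1 : ℝ) ≤ q₂ * q₁ * d := by
        have : (1 : ℝ) ≤ q₂ * q₁ := by nlinarith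
        nlinarith
      have h2 : (N : ℝ) ≤ 2 * q₂ := by linarith
      -- More than half of the agents and at least half of the times are selected, so `2 N m d ≤ 8
      -- q₂ q₁ d`; this is at most the square `(4 q₂ q₁ d)²` since `q₂ q₁ d ≥ 1`.
      have h3 : (N : ℝ) * (m * d) ≤ 4 * (q₂ * q₁ * d) := by
        calc (N : ℝ) * (m * d) = N * m * d := by ring
          _ ≤ (2 * q₂) * (2 * q₁) * d := by gcongr
          _ = _ := by ring
      nlinarith)
  -- the maximal temporal average of the noise
  have hne₃ : Nonempty (Fin N × Fin d) := ⟨(⟨0, hN⟩, ⟨0, hd⟩)⟩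
  have hBm := integral_pi_norm_le (μ := μ) (ι := Fin N × Fin d)
    (X := fun ω e => 1 / (q₁ : ℝ) * ∑ τ ∈ H (V ω) e.1, ξ e.1 τ ω e.2)
    (K := 4) (n := (2 * q₂ * d) ^ 2) hs0 hc0
    (fun e => measurable_apply_fiber hV
      (g := fun p ω => 1 / (q₁ : ℝ) * ∑ τ ∈ H p e.1, ξ e.1 τ ω e.2) fun p => by fun_prop)
    (fun e l hl hcl => integral_exp_abs_selected_mean_le hV
      (X := fun τ ω => ξ e.1 τ ω e.2) (fun τ => hξkm e.1 τ e.2) (fun τ => hξsub e.1 τ e.2)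
      (q := q₁) (by linarith) (by rw [Fintype.card_fin]; exact hq₁m')
      (sel := fun p => H p e.1) (fun p => by rw [hH p]) hl hcl)
    (by nlinarith) (by
      rw [Fintype.card_prod, Fintype.card_fin, Fintype.card_fin]
      push_cast
      -- Here a strict majority is used: `4N ≤ (N + 1)² ≤ (2 q₂)²`.
      have h1 : 4 * (N : ℝ) ≤ (2 * q₂) ^ 2 := by nlinarith [sq_nonneg ((N : ℝ) - 1)]
      have h2 : (d : ℝ) ≤ d ^ 2 := by nlinarith
      calc 4 * ((N : ℝ) * d) = 4 * N * d := by ring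
        _ ≤ (2 * q₂) ^ 2 * d ^ 2 := by gcongr
        _ = _ := by ring)
  simp_rw [← maxDev_eq] at hU hVm hBm
  have hM₁ := maxDev_nonneg hσ ha b hn₁.le
  have hM₃ := maxDev_nonneg hσ ha b hn₃.le
  have e1 : σ / Real.sqrt b * Real.sqrt d / Real.sqrt (q₂ * q₁)
      = σ * Real.sqrt d / Real.sqrt (q₁ * q₂ * b) := by
    rw [mul_comm (q₁ : ℝ), Real.sqrt_mul (by positivity : (0 : ℝ) ≤ q₂ * q₁)]
    field_simp
  have e2 := hBm.2.trans (maxDev_sq_le hσ b (by linarith))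
  have e3 := hVm.2.trans (maxDev_sq_le hσ b hn₃.le)
  obtain ⟨hA, hA'⟩ := hA
  rw [e1] at hA'
  have hSU := (integrable_finsetSum Finset.univ fun i _ => (hU i).1).const_mul (1 / (q₂ : ℝ))
  have e4 : ∫ ω, 1 / (q₂ : ℝ) * ∑ i, ‖fun e : Fin m × Fin d => ξ i e.1 ω e.2‖ ∂μ
      ≤ 2 * maxDev σ a b (4 * q₁ * d) := by
    rw [integral_const_mul, integral_finsetSum _ fun i _ => (hU i).1]
    calc _ ≤ 1 / (q₂ : ℝ) * ∑ _i : Fin N, maxDev σ a b (4 * q₁ * d) :=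
          mul_le_mul_of_nonneg_left (Finset.sum_le_sum fun i _ => (hU i).2) (by positivity)
      _ = N / q₂ * maxDev σ a b (4 * q₁ * d) := by
          rw [Finset.sum_const, Finset.card_univ, Fintype.card_fin, nsmul_eq_mul]; ring
      _ ≤ 2 * maxDev σ a b (4 * q₁ * d) := by
          gcongr
          rw [div_le_iff₀ (by linarith)]
          linarith
  obtain ⟨hi, hint⟩ := integral_affine_combination hA hBm.1 hVm.1 hSU E C₂ (C₂ * C₁) C₁
  refine ⟨hi, hint.trans_le ?_⟩
  have f2 := mul_le_mul_of_nonneg_left e2 hC₂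
  have f3 := mul_le_mul_of_nonneg_left e3 (mul_nonneg hC₂ hC₁)
  have f4 := mul_le_mul_of_nonneg_left e4 hC₁
  -- Slack: the noise maximum over all agents is bounded with the constant `2`, where the statement
  -- allows `4`.
  have f5 := mul_nonneg (mul_nonneg hC₂ hC₁) hM₃
  linarith

/-- Outside the failure event, the aggregation error is dominated by an integrable variable. -/
lemma exists_error_bound {Ω Z : Type*} [mΩ : MeasurableSpace Ω] [MeasurableSpace Z]
    {μ : Measure Ω} [IsProbabilityMeasure μ] {D : Measure Z} [IsProbabilityMeasure D]
    {d : ℕ} {f : Vec d → Z → ℝ} {L σ a : ℝ} (hL : 0 ≤ L) (hσ : 0 ≤ σ) (ha : 0 ≤ a)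
    (hf_meas : ∀ x, Measurable (f x)) (hf_smooth : ∀ z, IsSmooth L (fun x => f x z))
    (hf_subgamma : ∀ (k : Fin d) (x : Vec d),
      IsSubGamma D (fun z => gradient (fun y => f y z) x k - gradient (risk D f) x k) σ a)
    (hF : IsSmooth L (risk D f))
    {N m b m₀ K₁ K₂ n : ℕ} (hN : 1 ≤ N) (hm : 1 ≤ m) (hb : 1 ≤ b)
    {α₁ α₂ pb pt γ : ℝ} (hα₁ : α₁ < 1 / 2) (hα₂ : α₂ < 1 / 2)
    (hα₁m : α₁ * m = K₁) (hα₂N : α₂ * N = K₂)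
    (hpb : 0 ≤ pb) (hpb1 : pb ≤ 1) (hpt : 0 ≤ pt) (hpt1 : pt ≤ 1) (hγ : 0 ≤ γ)
    {ℱ : Filtration ℕ mΩ} {W : ℕ → Ω → Fin N → Bool} {ζ : ℕ → Ω → Fin N → Fin b → Z}
    (hSA : IsSASetting μ ℱ D pb pt W ζ)
    {x₁ : Vec d} {x : ℕ → Ω → Vec d} {g g' : ℕ → Fin N → Ω → Vec d} {g'' : ℕ → Ω → Vec d}
    (hrun : IsRangeRun ℱ f W ζ m α₁ α₂ γ x₁ n x g g' g'')
    {s : ℕ} (hs : 1 ≤ s) (hsn : s + (m₀ + m - 1) ≤ n) :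
    ∃ R : Ω → ℝ, Integrable R μ ∧ (∀ ω, 0 ≤ R ω) ∧
      (∀ ω, ω ∉ failEvent W m m₀ s α₁ α₂ →
        ‖g'' (s + (m₀ + m - 1)) ω - gradient (risk D f) (x (s + (m₀ + m - 1)) ω)‖ ≤ R ω) ∧
      ∫ ω, R ω ∂μ ≤ L * (γ * (m - 1))
          * (1 + constC d α₁ + 2 * constC d α₂ * (constC d α₁ + 1))
        + (σ * Real.sqrt d / Real.sqrt ((1 - α₁) * m * ((1 - α₂) * N) * b)
          + 2 * constC d α₂ * maxDev σ a b (2 * ((1 - α₂) * N) * d)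
          + 2 * constC d α₁ * maxDev σ a b (4 * ((1 - α₁) * m) * d)
          + 4 * constC d α₁ * constC d α₂
            * maxDev σ a b (4 * ((1 - α₂) * N) * ((1 - α₁) * m) * d)) := by
  have hm' : (1 : ℝ) ≤ m := by exact_mod_cast hm
  have hN' : (1 : ℝ) ≤ N := by exact_mod_cast hN
  have hα₁0 : 0 ≤ α₁ := by
    have : 0 ≤ α₁ * m := by rw [hα₁m]; positivity
    exact nonneg_of_mul_nonneg_left this (by linarith)
  have hα₂0 : 0 ≤ α₂ := by
    have : 0 ≤ α₂ * N := by rw [hα₂N]; positivity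
    exact nonneg_of_mul_nonneg_left this (by linarith)
  have hK₁ : 2 * K₁ < m := by
    have : (2 * K₁ : ℝ) < m := by rw [← hα₁m]; nlinarith
    exact_mod_cast this
  have hK₂ : 2 * K₂ < N := by
    have : (2 * K₂ : ℝ) < N := by rw [← hα₂N]; nlinarith
    exact_mod_cast this
  obtain ⟨q₁, hq₁⟩ : ∃ q, q = m - K₁ := ⟨_, rfl⟩
  obtain ⟨q₂, hq₂⟩ : ∃ q, q = N - K₂ := ⟨_, rfl⟩
  have eq₁ : (1 - α₁) * m = q₁ := by
    rw [hq₁, Nat.cast_sub (by omega), ← hα₁m]; ring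
  have eq₂ : (1 - α₂) * N = q₂ := by
    rw [hq₂, Nat.cast_sub (by omega), ← hα₂N]; ring
  have hC₁ := constC_nonneg d hα₁0 hα₁
  have hC₂ := constC_nonneg d hα₂0 hα₂
  obtain ⟨t, ht⟩ : ∃ t, t = s + (m₀ + m - 1) := ⟨_, rfl⟩
  rw [← ht] at hsn ⊢
  have hδ0 : 0 ≤ L * (γ * ((m : ℝ) - 1)) := by
    have : (0 : ℝ) ≤ (m : ℝ) - 1 := by linarith
    positivity
  -- In dimension zero all vectors coincide and both `C_α` vanish; it is treated apart because the
  -- maxima of noises need a nonempty index set.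
  rcases Nat.eq_zero_or_pos d with hd | hd
  · subst hd
    have hCz : ∀ α, constC 0 α = 0 := fun α => by simp [constC]
    refine ⟨fun _ => 0, integrable_const _, fun _ => le_rfl, fun ω _ => ?_, ?_⟩
    · rw [Subsingleton.elim (g'' t ω - gradient (risk D f) (x t ω)) 0, norm_zero]
    · rw [hCz, hCz]
      simpa using hδ0
  rw [eq₁, eq₂]
  choose G H hG hH hGH using
    exists_trustworthy_selection (N := N) (m := m) (m₀ := m₀) hm hα₁m hα₂N
  rw [← hq₂] at hG
  rw [← hq₁] at hH
  have hφ : ∀ k : Fin d, Measurable fun p : Vec d × (Fin b → Z) => batchNoise D f p.1 p.2 k := by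
    intro k
    have := measurable_batchNoise (b := b) hf_meas hf_smooth hF
    fun_prop
  have hsub : ∀ (k : Fin d) (y : Vec d), IsSubGamma (Measure.pi fun _ : Fin b => D)
      (fun z => batchNoise D f y z k) (σ / Real.sqrt b) (a / b) :=
    fun k y => isSubGamma_batchNoise hb hf_smooth hf_subgamma y k
  have hτs : ∀ τ : Fin m, s ≤ t - τ := fun τ => by omega
  have hτt : ∀ τ : Fin m, t - τ ≤ s + (m₀ + m - 1) := fun τ => by omega
  have hτ1 : ∀ τ : Fin m, 1 ≤ t - τ := fun τ => hs.trans (hτs τ)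
  have hXm : ∀ u, s ≤ u → u ≤ s + (m₀ + m - 1) → Measurable[ℱ (u - 1)] (x u) :=
    fun u h1 h2 => hrun.measurable_iterate (by omega) (by omega)
  have hV : ∀ p, MeasurableSet {ω | statePath W s (m₀ + m - 1) ω = p} :=
    fun p => hSA.measurableSet_statePath hs p
  have hξm : ∀ i (τ : Fin m),
      Measurable fun ω => batchNoise D f (x (t - τ) ω) (ζ (t - τ) ω i) := by
    intro i τ
    have h1 : Measurable (x (t - τ)) := (hXm _ (hτs τ) (hτt τ)).mono (ℱ.le _) le_rfl
    have h2 : Measurable (ζ (t - τ)) := (hSA.measurable_sample _ (hτ1 τ)).mono (ℱ.le _) le_rfl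
    have h3 : Measurable fun ω => ζ (t - τ) ω i := (measurable_pi_apply i).comp h2
    have h4 := measurable_batchNoise (D := D) (b := b) hf_meas hf_smooth hF
    fun_prop
  obtain ⟨hi, hint⟩ := integral_noise_bound_le hV (q₁ := q₁) (q₂ := q₂) hd hm hN hb (by omega)
    (by omega) hσ ha hξm
    (fun i τ k => hSA.isSubGamma_sample (hφ k) (hsub k) (hτ1 τ) (hXm _ (hτs τ) (hτt τ)) i)
    (fun k p i τ j τ' hne => hSA.setIntegral_statePath_mul_eq_zero hpb hpb1 hpt hpt1 (hφ k)
      (hsub k) hs (hτs τ) (hτt τ) (hτs τ') (hτt τ') hXm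
      (fun h1 => hne (by ext; omega)) p)
    (fun k p i τ => hSA.setIntegral_statePath_sq_sub_nonpos hpb hpb1 hpt hpt1 (hφ k) (hsub k) hs
      (hτs τ) (hτt τ) (hXm _ (hτs τ) (hτt τ)) i p)
    (fun p => hG p) (fun p => hH p)
    (E := L * (γ * ((m : ℝ) - 1)) * (1 + constC d α₁ + constC d α₂ * (constC d α₁ + 1)))
    hC₁ hC₂
  -- The dominating variable `R` is the integrand of the preceding bound. It is nonnegative
  -- everywhere but bounds the aggregation error only outside the failure event.
  refine ⟨_, hi, fun ω => ?_, fun ω hω => ?_, hint.trans ?_⟩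
  · have : 0 ≤ ∑ i, ‖fun e : Fin m × Fin d =>
        batchNoise D f (x (t - e.1) ω) (ζ (t - e.1) ω i) e.2‖ :=
      Finset.sum_nonneg fun i _ => norm_nonneg _
    positivity
  · have key := norm_aggregate_sub_le hd hN hm hα₁0 hα₁ hα₂0 hα₂
      (v := fun i τ => g (t - τ) i ω)
      (ξ := fun i τ => batchNoise D f (x (t - τ) ω) (ζ (t - τ) ω i)) (u := fun i => g' t i ω)
      (w := g'' t ω) (y₀ := gradient (risk D f) (x t ω))
      (y := fun τ => gradient (risk D f) (x (t - τ) ω))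
      (fun i => hrun.temporal t (by omega) hsn (by omega) i ω)
      (hrun.aggregate t (by omega) hsn ω)
      (G := G (statePath W s (m₀ + m - 1) ω)) (H := H (statePath W s (m₀ + m - 1) ω))
      (δ := L * (γ * ((m : ℝ) - 1)))
      (by rw [eq₂, hG]) (fun i => by rw [eq₁, hH])
      (fun i hi τ hτ => by
        have hst : W (t - τ) ω i = false := by
          have h1 := hGH (statePath W s (m₀ + m - 1) ω) hω i hi τ hτ
          have h2 : s + (m₀ + m - 1 - (τ : ℕ)) = t - τ := by omega
          rw [← h2]
          exact h1
        rw [hrun.trustworthy (t - τ) (hτ1 τ) (by omega) i ω hst]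
        exact (add_sub_cancel _ _).symm)
      (fun τ => by
        rw [norm_sub_rev]
        -- The gradient at a time `τ ≤ m - 1` steps back differs from the current one by at most `L
        -- γ τ`, which is at most the drift `δ`.
        have h1 := hrun.norm_gradient_sub_le hγ hL hF (hτ1 τ) τ (by omega) ω
        rw [Nat.sub_add_cancel (by omega)] at h1
        refine h1.trans ?_
        have h2 : ((τ : ℕ) : ℝ) ≤ (m : ℝ) - 1 := by
          have : ((τ : ℕ) : ℝ) + 1 ≤ m := by exact_mod_cast τ.2
          linarith
        gcongr)
      (fun i τ k => norm_le_pi_norm (fun e : Fin m × Fin d =>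
        batchNoise D f (x (t - e.1) ω) (ζ (t - e.1) ω i) e.2) (τ, k))
      (fun i τ k => norm_le_pi_norm (fun e : Fin N × Fin m × Fin d =>
        batchNoise D f (x (t - e.2.1) ω) (ζ (t - e.2.1) ω e.1) e.2.2) (i, τ, k))
      (fun i k => by
        rw [eq₁]
        exact norm_le_pi_norm (fun e : Fin N × Fin d => 1 / (q₁ : ℝ)
          * ∑ τ ∈ H (statePath W s (m₀ + m - 1) ω) e.1,
            batchNoise D f (x (t - τ) ω) (ζ (t - τ) ω e.1) e.2) (i, k))
    rw [eq₁, eq₂] at key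
    exact key
  · have f1 : L * (γ * ((m : ℝ) - 1)) * (1 + constC d α₁ + constC d α₂ * (constC d α₁ + 1))
        ≤ L * (γ * ((m : ℝ) - 1))
          * (1 + constC d α₁ + 2 * constC d α₂ * (constC d α₁ + 1)) := by
      gcongr
      linarith
    linarith

/-! ### Telescoped descent and the theorem -/

/-- A per-step descent inequality holding up to an event `Z j` of small conditional probability
bounds the expected sum of the step measures `A j`. -/
lemma sum_integral_le_of_descent {Ω : Type*} [MeasurableSpace Ω] {μ : Measure Ω}
    [IsProbabilityMeasure μ] {T : ℕ} {γ P c e ρ D₀ : ℝ} (hγ : 0 ≤ γ)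
    {Φ A R : ℕ → Ω → ℝ} {Z : ℕ → Set Ω}
    (hZ : ∀ j < T, MeasurableSet (Z j)) (hA : ∀ j < T, Integrable (A j) μ)
    (hR : ∀ j < T, Integrable (R j) μ)
    (hstep : ∀ j < T, ∀ ω, γ * A j ω
      ≤ Φ j ω - Φ (j + 1) ω + 2 * γ * (Z j).indicator (A j) ω + 2 * γ * R j ω + c)
    (hΦ : ∀ ω, Φ 0 ω - Φ T ω ≤ D₀)
    (hZA : ∀ j < T, ∫ ω in Z j, A j ω ∂μ ≤ P * (∫ ω, A j ω ∂μ + e))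
    (hRρ : ∀ j < T, ∫ ω, R j ω ∂μ ≤ ρ) :
    γ * (1 - 2 * P) * ∑ j ∈ Finset.range T, ∫ ω, A j ω ∂μ
      ≤ D₀ + T * (2 * γ * P * e + 2 * γ * ρ + c) := by
  have hiZ : ∀ j < T, Integrable ((Z j).indicator (A j)) μ :=
    fun j hj => (hA j hj).indicator (hZ j hj)
  have hi : ∀ j ∈ Finset.range T, Integrable
      (fun ω => γ * A j ω - 2 * γ * (Z j).indicator (A j) ω - 2 * γ * R j ω) μ := fun j hj => by
    rw [Finset.mem_range] at hj
    exact (((hA j hj).const_mul γ).sub ((hiZ j hj).const_mul (2 * γ))).sub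
      ((hR j hj).const_mul (2 * γ))
  have h1 : ∫ ω, ∑ j ∈ Finset.range T,
      (γ * A j ω - 2 * γ * (Z j).indicator (A j) ω - 2 * γ * R j ω) ∂μ ≤ D₀ + T * c := by
    refine (integral_mono (integrable_finsetSum _ hi) (integrable_const (D₀ + T * c))
      fun ω => ?_).trans_eq (by simp)
    have h2 : ∑ j ∈ Finset.range T,
        (γ * A j ω - 2 * γ * (Z j).indicator (A j) ω - 2 * γ * R j ω)
        ≤ ∑ j ∈ Finset.range T, ((Φ j ω - Φ (j + 1) ω) + c) :=
      Finset.sum_le_sum fun j hj => by linarith [hstep j (Finset.mem_range.mp hj) ω]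
    rw [Finset.sum_add_distrib, Finset.sum_range_sub' (fun j => Φ j ω)] at h2
    simp only [Finset.sum_const, Finset.card_range, nsmul_eq_mul] at h2
    exact h2.trans (by linarith [hΦ ω])
  rw [integral_finsetSum _ hi] at h1
  have h3 : ∀ j ∈ Finset.range T, γ * (1 - 2 * P) * ∫ ω, A j ω ∂μ
      ≤ ∫ ω, (γ * A j ω - 2 * γ * (Z j).indicator (A j) ω - 2 * γ * R j ω) ∂μ
        + (2 * γ * P * e + 2 * γ * ρ) := fun j hj => by
    rw [Finset.mem_range] at hj
    have i1 : Integrable (fun ω => γ * A j ω) μ := (hA j hj).const_mul γ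
    have i2 : Integrable (fun ω => 2 * γ * (Z j).indicator (A j) ω) μ :=
      (hiZ j hj).const_mul (2 * γ)
    have i3 : Integrable (fun ω => 2 * γ * R j ω) μ := (hR j hj).const_mul (2 * γ)
    have i12 : Integrable (fun ω => γ * A j ω - 2 * γ * (Z j).indicator (A j) ω) μ := i1.sub i2
    rw [integral_sub i12 i3, integral_sub i1 i2, integral_const_mul, integral_const_mul,
      integral_const_mul, integral_indicator (hZ j hj)]
    have := mul_le_mul_of_nonneg_left (hZA j hj) hγ
    have := mul_le_mul_of_nonneg_left (hRρ j hj) hγ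
    linarith
  rw [Finset.mul_sum]
  refine (Finset.sum_le_sum h3).trans ?_
  rw [Finset.sum_add_distrib]
  simp only [Finset.sum_const, Finset.card_range, nsmul_eq_mul]
  linarith

theorem theorem4 {Ω Z : Type*} [mΩ : MeasurableSpace Ω] [MeasurableSpace Z]
    (μ : Measure Ω) [IsProbabilityMeasure μ] (D : Measure Z) [IsProbabilityMeasure D]
    -- problem: smooth cost, sub-gamma partial derivatives, a minimizer of `F` on `ℝ^d`
    {d : ℕ} (f : Vec d → Z → ℝ) (L σ a : ℝ) (hL : 0 < L) (hσ : 0 ≤ σ) (ha : 0 ≤ a)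
    (hf_meas : ∀ x, Measurable (f x)) (hf_int : ∀ x, Integrable (f x) D)
    (hf_smooth : ∀ z, IsSmooth L (fun x => f x z))
    (hf_subgamma : ∀ (k : Fin d) (x : Vec d),
      IsSubGamma D (fun z => gradient (fun y => f y z) x k - gradient (risk D f) x k) σ a)
    (xstar : Vec d) (hxstar : ∀ x, risk D f xstar ≤ risk D f x)
    -- network and algorithm parameters
    (N m b m₀ T : ℕ) (hN : 1 ≤ N) (hm : 1 ≤ m) (hb : 1 ≤ b) (hT : 1 ≤ T)
    (α₁ α₂ pb pt γ₀ : ℝ) (hα₁ : α₁ < 1 / 2) (hα₂ : α₂ < 1 / 2)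
    (hα₁m : ∃ k : ℕ, α₁ * m = k) (hα₂N : ∃ k : ℕ, α₂ * N = k)
    (hpb : 0 < pb) (hpbt : pb < pt) (hpt : pt < 1) (hγ₀ : 0 < γ₀)
    (hP : PZ m m₀ N α₁ α₂ pb pt < 1 / 2)
    -- random environment and a run of the algorithm with step size `γ₀ / √T`
    (ℱ : Filtration ℕ mΩ) (W : ℕ → Ω → Fin N → Bool) (ζ : ℕ → Ω → Fin N → Fin b → Z)
    (hSA : IsSASetting μ ℱ D pb pt W ζ)
    (x₁ : Vec d) (x : ℕ → Ω → Vec d) (g g' : ℕ → Fin N → Ω → Vec d) (g'' : ℕ → Ω → Vec d)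
    (hrun : IsRangeRun ℱ f W ζ m α₁ α₂ (γ₀ / Real.sqrt T) x₁ (T + m - 1 + m₀) x g g' g'') :
    (∀ t ∈ Finset.Icc (m + m₀) (T + m - 1 + m₀),
      Integrable (fun ω => ‖gradient (risk D f) (x t ω)‖) μ) ∧
    1 / (T : ℝ) * ∑ t ∈ Finset.Icc (m + m₀) (T + m - 1 + m₀),
        ∫ ω, ‖gradient (risk D f) (x t ω)‖ ∂μ
      ≤ (risk D f x₁ - risk D f xstar)
            / (Real.sqrt T * γ₀ * (1 - 2 * PZ m m₀ N α₁ α₂ pb pt))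
        + constCbar L m m₀ (PZ m m₀ N α₁ α₂ pb pt) (constC d α₁) (constC d α₂) * γ₀
            / (Real.sqrt T * (1 - 2 * PZ m m₀ N α₁ α₂ pb pt))
        -- terms of order `1 / T`
        + ‖gradient (risk D f) x₁‖ * ((m : ℝ) - 1 + m₀)
            / (T * (1 - 2 * PZ m m₀ N α₁ α₂ pb pt))
        + L * γ₀ * ((m : ℝ) - 1 + m₀) ^ 2
            / (2 * (T : ℝ) ^ (3 / 2 : ℝ) * (1 - 2 * PZ m m₀ N α₁ α₂ pb pt))
        -- statistical error
        + (2 * σ * Real.sqrt d / Real.sqrt ((1 - α₁) * m * ((1 - α₂) * N) * b)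
            + 4 * constC d α₂ * maxDev σ a b (2 * ((1 - α₂) * N) * d)
            + 4 * constC d α₁ * maxDev σ a b (4 * ((1 - α₁) * m) * d)
            + 8 * constC d α₁ * constC d α₂
                * maxDev σ a b (4 * ((1 - α₂) * N) * ((1 - α₁) * m) * d))
            / (1 - 2 * PZ m m₀ N α₁ α₂ pb pt) := by
  classical
  have hL0 := hL.le
  have hF : IsSmooth L (risk D f) :=
    risk_isSmooth hf_int hf_smooth (integrable_gradient hf_meas hf_smooth hf_subgamma)
  obtain ⟨K₁, hK₁⟩ := hα₁m
  obtain ⟨K₂, hK₂⟩ := hα₂N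
  have hpb1 : pb ≤ 1 := by linarith
  have hpt0 : 0 ≤ pt := by linarith
  have hTr : (1 : ℝ) ≤ T := by exact_mod_cast hT
  have hsT : 0 < Real.sqrt T := Real.sqrt_pos.mpr (by linarith)
  obtain ⟨γ, hγdef⟩ : ∃ γ, γ = γ₀ / Real.sqrt T := ⟨_, rfl⟩
  have hγ : 0 < γ := hγdef ▸ div_pos hγ₀ hsT
  rw [← hγdef] at hrun
  obtain ⟨n₀, hn₀⟩ : ∃ n, n = m₀ + m - 1 := ⟨_, rfl⟩
  have hn₀r : (n₀ : ℝ) = (m : ℝ) - 1 + m₀ := by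
    have : n₀ + 1 = m + m₀ := by omega
    have : (n₀ : ℝ) + 1 = m + m₀ := by exact_mod_cast this
    linarith
  have hP0 : 0 ≤ PZ m m₀ N α₁ α₂ pb pt := PZ_nonneg hpb.le hpb1 hpt0 hpt.le
  have hint : ∀ t, 1 ≤ t → t ≤ T + m - 1 + m₀ + 1 →
      Integrable (fun ω => ‖gradient (risk D f) (x t ω)‖) μ :=
    fun t h1 h2 => hrun.integrable_norm_gradient hγ.le hL0 hF h1 h2
  refine ⟨fun t ht => hint t (by rw [Finset.mem_Icc] at ht; omega)
    (by rw [Finset.mem_Icc] at ht; omega), ?_⟩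
  have hIcc : Finset.Icc (m + m₀) (T + m - 1 + m₀) = Finset.Ico (m + m₀) (m + m₀ + T) := by
    ext t; rw [Finset.mem_Icc, Finset.mem_Ico]; omega
  rw [hIcc, Finset.sum_Ico_eq_sum_range, Nat.add_sub_cancel_left]
  have herr : ∀ j, j < T → _ := fun j hj =>
    exists_error_bound hL0 hσ ha hf_meas hf_smooth hf_subgamma hF (m₀ := m₀) hN hm hb hα₁ hα₂
      hK₁ hK₂ hpb.le hpb1 hpt0 hpt.le hγ.le hSA hrun (s := 1 + j) (by omega) (by omega)
  choose! R hRi hR0 hRle hRint using herr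
  -- The index `j` stands for the iteration `m + m₀ + j`, whose failure is judged from the states at
  -- time `1 + j`, that is, `n₀ = m₀ + m - 1` steps earlier. `D₀` includes the cost of the first
  -- `n₀` iterations, and `e` contains two shifts by `n₀` steps.
  have hmain := sum_integral_le_of_descent (μ := μ) (T := T) (γ := γ)
    (P := PZ m m₀ N α₁ α₂ pb pt) (c := L / 2 * γ ^ 2) (e := 2 * (L * (γ * n₀)))
    (D₀ := risk D f x₁ - risk D f xstar + ‖gradient (risk D f) x₁‖ * (γ * n₀)
      + L / 2 * (γ * n₀) ^ 2) hγ.le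
    (Φ := fun j ω => risk D f (x (m + m₀ + j) ω))
    (A := fun j ω => ‖gradient (risk D f) (x (m + m₀ + j) ω)‖) (R := R)
    (Z := fun j => failEvent W m m₀ (1 + j) α₁ α₂)
    (fun j _ => hSA.measurableSet_failEvent (by omega) m m₀ α₁ α₂)
    (fun j hj => hint _ (by omega) (by omega)) hRi
    (fun j hj ω => by
      have hu := hrun.update (m + m₀ + j) (by omega) (by omega) ω
      obtain ⟨b1, b2⟩ := hF.normalized_step hL0 hγ.le (x (m + m₀ + j) ω) (g'' (m + m₀ + j) ω)
      rw [← hu] at b1 b2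
      have hR := mul_nonneg hγ.le (hR0 j hj ω)
      -- On failure, the worst-case increase `γ ‖∇F‖` is written as `-γ ‖∇F‖ + 2γ ‖∇F‖`; the last
      -- term is the indicator term.
      by_cases hω : ω ∈ failEvent W m m₀ (1 + j) α₁ α₂
      · rw [Set.indicator_of_mem hω]
        simp only [← add_assoc] at b1 ⊢
        linarith
      · rw [Set.indicator_of_notMem hω]
        have h1 := hRle j hj ω hω
        rw [show 1 + j + (m₀ + m - 1) = m + m₀ + j by omega] at h1
        have h2 := mul_le_mul_of_nonneg_left h1 hγ.le
        simp only [← add_assoc] at b2 ⊢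
        linarith)
    (fun ω => by
      -- The descent starts from the iterate at time `1 + n₀ = m + m₀`, within distance `γ n₀` of
      -- `x₁`. The quadratic upper bound at `x₁` yields the two terms of the theorem with `T` and
      -- `T^(3/2)` in the denominator.
      have h1 := (abs_le.mp (hF.abs_sub_linear_le (x 1 ω) (x (1 + n₀) ω))).2
      have h2 := hrun.norm_iterate_sub_le hγ.le le_rfl n₀ (by omega) ω
      rw [show 1 + n₀ = m + m₀ + 0 by omega] at h1 h2
      rw [hrun.init] at h1 h2
      have h3 := (real_inner_le_norm (gradient (risk D f) x₁) (x (m + m₀ + 0) ω - x₁)).trans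
        (mul_le_mul_of_nonneg_left h2 (norm_nonneg _))
      have h4 : L / 2 * ‖x (m + m₀ + 0) ω - x₁‖ ^ 2 ≤ L / 2 * (γ * n₀) ^ 2 := by gcongr
      have h5 := hxstar (x (m + m₀ + T) ω)
      linarith)
    (fun j hj => by
      -- The current gradient norm is not known at time `1 + j`. It is replaced by the one at that
      -- time plus `L γ n₀`, the failure bound is applied, and the exchange is undone, which costs
      -- `L γ n₀` once more.
      have hs : 1 ≤ 1 + j := by omega
      have hi1 := hint (1 + j) (by omega) (by omega)
      have hi2 := hint (m + m₀ + j) (by omega) (by omega)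
      have hdiff : ∀ ω, |‖gradient (risk D f) (x (m + m₀ + j) ω)‖
          - ‖gradient (risk D f) (x (1 + j) ω)‖| ≤ L * (γ * n₀) := fun ω => by
        have h1 := hrun.norm_gradient_sub_le hγ.le hL0 hF hs n₀ (by omega) ω
        rw [show 1 + j + n₀ = m + m₀ + j by omega] at h1
        exact (abs_norm_sub_norm_le _ _).trans h1
      have hY0 : ∀ ω, 0 ≤ ‖gradient (risk D f) (x (1 + j) ω)‖ + L * (γ * n₀) :=
        fun ω => by positivity
      have hYm : StronglyMeasurable[ℱ (1 + j)]
          fun ω => ‖gradient (risk D f) (x (1 + j) ω)‖ + L * (γ * n₀) := by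
        have h1 : Measurable[ℱ (1 + j)] (x (1 + j)) :=
          (hrun.measurable_iterate hs (by omega)).mono (ℱ.mono (by omega)) le_rfl
        have h2 : Measurable fun y : Vec d => ‖gradient (risk D f) y‖ + L * (γ * n₀) :=
          (hF.continuous_gradient.norm.add continuous_const).measurable
        exact (h2.comp h1).stronglyMeasurable
      have hYi : Integrable
          (fun ω => ‖gradient (risk D f) (x (1 + j) ω)‖ + L * (γ * n₀)) μ :=
        hi1.add (integrable_const _)
      refine (integral_mono hi2.integrableOn hYi.integrableOn fun ω => ?_).trans
        ((hSA.setIntegral_failEvent_le hs m m₀ α₁ α₂ hYm hYi hY0).trans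
          (mul_le_mul_of_nonneg_left ?_ hP0))
      · have := (abs_le.mp (hdiff ω)).2
        dsimp only
        linarith
      · have h3 : ∫ ω, (‖gradient (risk D f) (x (1 + j) ω)‖ + L * (γ * n₀)) ∂μ
            ≤ ∫ ω, (‖gradient (risk D f) (x (m + m₀ + j) ω)‖ + 2 * (L * (γ * n₀))) ∂μ :=
          integral_mono hYi (hi2.add (integrable_const _)) fun ω => by
            have := (abs_le.mp (hdiff ω)).1
            dsimp only
            linarith
        refine h3.trans_eq ?_
        rw [integral_add hi2 (integrable_const _)]
        simp)
    hRint
  have hΔ : 0 < 1 - 2 * PZ m m₀ N α₁ α₂ pb pt := by linarith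
  have hT32 : (T : ℝ) ^ (3 / 2 : ℝ) = T * Real.sqrt T := by
    rw [show (3 / 2 : ℝ) = 1 + 1 / 2 by norm_num, Real.rpow_add (by linarith), Real.rpow_one,
      Real.sqrt_eq_rpow]
  have hTsq : (T : ℝ) = Real.sqrt T ^ 2 := (Real.sq_sqrt (by linarith)).symm
  rw [hT32, ← hn₀r]
  have hdiv := mul_le_mul_of_nonneg_left ((le_div_iff₀' (mul_pos hγ hΔ)).mpr hmain)
    (one_div_nonneg.mpr (zero_le_one.trans hTr))
  -- After division by `γ Δ T` the bound is exactly the stated one; the contributions `2γP e`, `2γ`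
  -- times the drift, and `L γ² / 2` combine into `constCbar`.
  refine hdiv.trans (le_of_eq ?_)
  rw [hγdef, constCbar, ← hn₀r]
  generalize PZ m m₀ N α₁ α₂ pb pt = P at *
  generalize Real.sqrt ((1 - α₁) * m * ((1 - α₂) * N) * b) = q
  generalize maxDev σ a b (2 * ((1 - α₂) * N) * d) = M₁
  generalize maxDev σ a b (4 * ((1 - α₁) * m) * d) = M₂
  generalize maxDev σ a b (4 * ((1 - α₂) * N) * ((1 - α₁) * m) * d) = M₃
  generalize 1 - 2 * P = Δ at *
  generalize ‖gradient (risk D f) x₁‖ = G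
  generalize Real.sqrt T = r at *
  rw [hTsq]
  rw [show 2 * σ * Real.sqrt d / q = 2 * (σ * Real.sqrt d / q) by ring]
  generalize σ * Real.sqrt d / q = Q
  field_simp
  ring
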